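/- Let $\mathcal{E}$ be an additive category. A morphism $f$ in an additive category with kernels and cokernels is *strict* if the canonical morphism $\operatorname{coker}\ker f\to\ker\operatorname{coker} f$ is an isomorphism. $\mathcal{E}$ is *quasi-abelian* if it has kernels and cokernels, every pullback of a strict epimorphism is a strict epimorphism, and every pushout of a strict monomorphism is a strict monomorphism. A *torsion pair* $(\mathcal{T},\mathcal{F})$ in an abelian category $\mathcal{C}$ consists of two strictly full subcategories with $\operatorname{Hom}(\mathcal{T},\mathcal{F})=0$ such that every object $C$ of $\mathcal C$ fits in an exact sequence $0\to T\to C\to F\to 0$ with $T\in\mathcal{T}$, $F\in\mathcal{F}$. It is *tilting* if every object of $\mathcal{C}$ is a subobject of an object of $\mathcal{T}$, and *cotilting* if every object of $\mathcal{C}$ is a quotient of an object of $\mathcal{F}$. For a quasi-abelian category $\mathcal{E}$, a complex $L$ is *strictly exact in degree $n$* if $d^{n-1}$ is strict and $\operatorname{im} d^{n-1}\to\ker d^n$ is an isomorphism, where $\operatorname{im}=\ker\operatorname{coker}$; $D(\mathcal{E})$ is the Verdier quotient of the homotopy category $K(\mathcal{E})$ of unbounded complexes by the complexes that are strictly exact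 in all degrees. The *left heart* $\mathcal{LH}(\mathcal{E})\subset D(\mathcal{E})$ is the heart $D^{\le 0}\cap D^{\ge 0}$ of the left t-structure, where $D^{\le 0}$ (resp. $D^{\ge 0}$) consists of the objects isomorphic to complexes strictly exact in all degrees $n>0$ (resp. $n<0$). The *right heart* is its dual, $\mathcal{RH}(\mathcal{E})=\mathcal{LH}(\mathcal{E}^{\mathrm{op}})^{\mathrm{op}}$. $\mathcal{E}$ maps to both hearts by sending an object to the complex concentrated in degree $0$. Then the following are equivalent: 1. $\mathcal{E}$ is quasi-abelian. 2. There is a cotilting torsion pair $(\mathcal{T},\mathcal{F})$ in an abelian category $\mathcal{C}$ with $\mathcal{E}\cong\mathcal{F}$. 3. There is a tilting torsion pair $(\mathcal{T}',\mathcal{F}')$ in an abelian category $\mathcal{C}'$ with $\mathcal{E}\cong\mathcal{T}'$. Moreover, for every $(\mathcal{C},\mathcal{T},\mathcal{F})$ and equivalence $\mathcal{E}\cong\mathcal{F}$ as in (2), there is an equivalence $\mathcal{LH}(\mathcal{E})\cong\mathcal{C}$, and for every $(\mathcal{C}',\mathcal{T}',\mathcal{F}')$ and equivalence $\mathcal{E}\cong\mathcal{T}'$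 as in (3), there is an equivalence $\mathcal{RH}(\mathcal{E})\cong\mathcal{C}'$; these equivalences are compatible, up to isomorphism, with the functors from $\mathcal{E}$. -/

import Mathlib

open CategoryTheory CategoryTheory.Limits

universe w' w v u

noncomputable section

namespace QuasiAbelian

/-! ### Strict morphisms and quasi-abelian categories

Throughout, an additive category is a preadditive category with a zero object and binary
biproducts. -/

section Strict

variable {E : Type u} [Category.{v} E] [Preadditive E] [HasKernels E] [HasCokernels E]

/-- A morphism `f` is strict if the canonical morphism `coker (ker f) ⟶ ker (coker f)` is an
isomorphism. -/
def IsStrict {X Y : E} (f : X ⟶ Y) : Prop :=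
  IsIso (Abelian.coimageImageComparison f)

/-- A strict epimorphism: an epimorphism which is strict. -/
def IsStrictEpi {X Y : E} (f : X ⟶ Y) : Prop := Epi f ∧ IsStrict f

/-- A strict monomorphism: a monomorphism which is strict. -/
def IsStrictMono {X Y : E} (f : X ⟶ Y) : Prop := Mono f ∧ IsStrict f

end Strict

/-- An additive category is quasi-abelian if it has kernels and cokernels, if every pullback of a
strict epimorphism is a strict epimorphism and every pushout of a strict monomorphism is a strict
monomorphism. -/
class IsQuasiAbelian (E : Type u) [Category.{v} E] [Preadditive E] [HasZeroObject E]
    [HasBinaryBiproducts E] : Prop where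
  [hasKernels : HasKernels E]
  [hasCokernels : HasCokernels E]
  isStrictEpi_of_isPullback : ∀ {P X Y Z : E} {fst : P ⟶ X} {snd : P ⟶ Y} {f : X ⟶ Z} {g : Y ⟶ Z},
    IsPullback fst snd f g → IsStrictEpi g → IsStrictEpi fst
  isStrictMono_of_isPushout : ∀ {Z X Y P : E} {f : Z ⟶ X} {g : Z ⟶ Y} {inl : X ⟶ P} {inr : Y ⟶ P},
    IsPushout f g inl inr → IsStrictMono f → IsStrictMono inr

attribute [instance] IsQuasiAbelian.hasKernels IsQuasiAbelian.hasCokernels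

/-! ### Strictly exact complexes -/

section StrictlyExact

variable {E : Type u} [Category.{v} E] [Preadditive E] [HasKernels E] [HasCokernels E]

theorem image_ι_comp_g_eq_zero (S : ShortComplex E) : Abelian.image.ι S.f ≫ S.g = 0 := by
  rw [← cokernel.π_desc S.f S.g S.zero, kernel.condition_assoc, zero_comp]

/-- A sequence `X₁ ⟶ X₂ ⟶ X₃` with zero composition is strictly exact if its first morphism is
strict and the canonical morphism from the image of the first morphism to the kernel of
the second one is an isomorphism. -/
def StrictlyExact (S : ShortComplex E) : Prop :=
  IsStrict S.f ∧ IsIso (kernel.lift S.g (Abelian.image.ι S.f) (image_ι_comp_g_eq_zero S))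

/-- Strict exactness of a complex `K` at the degree `n`, i.e. strict exactness of the sequence
`Kⁿ⁻¹ ⟶ Kⁿ ⟶ Kⁿ⁺¹`. -/
def StrictlyExactAt (K : CochainComplex E ℤ) (n : ℤ) : Prop := StrictlyExact (K.sc n)

theorem strictlyExact_of_isZero {S : ShortComplex E} (h : IsZero S.X₂) : StrictlyExact S := by
  have hf : S.f = 0 := h.eq_of_tgt _ _
  have h1 : IsZero (Abelian.image S.f) := IsZero.of_mono (Abelian.image.ι S.f) h
  have h2 : IsZero (kernel S.g) := IsZero.of_mono (kernel.ι S.g) h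
  have h3 : IsZero (Abelian.coimage S.f) := by
    have : Abelian.coimage.π S.f = 0 := by
      have hk : kernel.lift S.f (𝟙 S.X₁) (by simp [hf]) ≫ kernel.ι S.f = 𝟙 _ := by simp
      have hc : kernel.ι S.f ≫ Abelian.coimage.π S.f = 0 := cokernel.condition _
      rw [← Category.id_comp (Abelian.coimage.π S.f), ← hk, Category.assoc, hc, comp_zero]
    exact IsZero.of_epi_eq_zero _ this
  exact ⟨h3.isIso h1 _, h1.isIso h2 _⟩

theorem strictlyExactAt_single [HasZeroObject E] (X : E) (n : ℤ) (hn : n ≠ 0) :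
    StrictlyExactAt ((HomologicalComplex.single E (ComplexShape.up ℤ) 0).obj X) n :=
  strictlyExact_of_isZero (HomologicalComplex.isZero_single_obj_X (ComplexShape.up ℤ) 0 X n hn)

end StrictlyExact

/-! ### The derived category of a quasi-abelian category and its left heart -/

section LeftHeart

variable (E : Type u) [Category.{v} E] [Preadditive E] [HasZeroObject E] [HasBinaryBiproducts E]
  [HasKernels E] [HasCokernels E]

/-- The homotopy category `K(E)` of unbounded cochain complexes. -/
abbrev HoCat : Type (max u v) := HomotopyCategory E (ComplexShape.up ℤ)

/-- The objects of `K(E)` that are isomorphic to a complex which is strictly exact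
in every degree. -/
def acyclic : ObjectProperty (HoCat E) := fun X =>
  ∃ L : CochainComplex E ℤ, (∀ n : ℤ, StrictlyExactAt L n) ∧
    Nonempty ((HomotopyCategory.quotient E (ComplexShape.up ℤ)).obj L ≅ X)

/-- The derived category `D(E)`: the Verdier quotient of `K(E)` by the strictly exact complexes,
i.e. the localization of `K(E)` at the morphisms whose cone is strictly exact. -/
abbrev DerCat : Type (max u v) := (acyclic E).trW.Localization

/-- The canonical functor from complexes to the derived category. -/
abbrev toDerCat : CochainComplex E ℤ ⥤ DerCat E :=
  HomotopyCategory.quotient E (ComplexShape.up ℤ) ⋙ (acyclic E).trW.Q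

/-- `D^{≤ 0}` of the left t-structure: the complexes that are strictly exact in every
degree `n > 0`. -/
def leftLE : ObjectProperty (DerCat E) := fun X =>
  ∃ L : CochainComplex E ℤ, (∀ n : ℤ, 0 < n → StrictlyExactAt L n) ∧ Nonempty ((toDerCat E).obj L ≅ X)

/-- `D^{≥ 0}` of the left t-structure: the complexes that are strictly exact in every
degree `n < 0`. -/
def leftGE : ObjectProperty (DerCat E) := fun X =>
  ∃ L : CochainComplex E ℤ, (∀ n : ℤ, n < 0 → StrictlyExactAt L n) ∧ Nonempty ((toDerCat E).obj L ≅ X)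

/-- The left heart `LH(E)`: the heart `D^{≤ 0} ∩ D^{≥ 0}` of the left t-structure on `D(E)`. -/
abbrev LeftHeart : Type (max u v) := (leftLE E ⊓ leftGE E).FullSubcategory

/-- The canonical functor `E ⥤ LH(E)`, sending an object to the corresponding complex
concentrated in degree `0`. -/
def toLeftHeart : E ⥤ LeftHeart E :=
  (leftLE E ⊓ leftGE E).lift (HomologicalComplex.single E (ComplexShape.up ℤ) 0 ⋙ toDerCat E)
    (fun X => ⟨⟨_, fun n hn => strictlyExactAt_single X n hn.ne', ⟨Iso.refl _⟩⟩,
      ⟨_, fun n hn => strictlyExactAt_single X n hn.ne, ⟨Iso.refl _⟩⟩⟩)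

end LeftHeart

/-! ### The right heart, by duality -/

section RightHeart

variable (E : Type u) [Category.{v} E] [Preadditive E]

instance hasBinaryBiproducts_opposite [HasBinaryBiproducts E] : HasBinaryBiproducts Eᵒᵖ :=
  HasBinaryBiproducts.of_hasBinaryProducts

instance hasKernels_opposite [HasCokernels E] : HasKernels Eᵒᵖ where
  has_limit f := ⟨⟨_, CokernelCofork.IsColimit.ofπOp _ (cokernel.condition f.unop)
    (cokernelIsCokernel f.unop)⟩⟩

instance hasCokernels_opposite [HasKernels E] : HasCokernels Eᵒᵖ where
  has_colimit f := ⟨⟨_, KernelFork.IsLimit.ofιOp _ (kernel.condition f.unop)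
    (kernelIsKernel f.unop)⟩⟩

variable [HasZeroObject E] [HasBinaryBiproducts E] [HasKernels E] [HasCokernels E]

/-- The right heart `RH(E)`, the dual of the left heart: `RH(E) = LH(Eᵒᵖ)ᵒᵖ`. -/
abbrev RightHeart : Type (max u v) := (LeftHeart Eᵒᵖ)ᵒᵖ

/-- The canonical functor `E ⥤ RH(E)`, sending an object to the corresponding complex
concentrated in degree `0`. -/
def toRightHeart : E ⥤ RightHeart E := (toLeftHeart Eᵒᵖ).rightOp

end RightHeart

/-! ### Torsion pairs -/

/-- A torsion pair in an abelian category: two strictly full subcategories such that there are no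
nonzero morphisms from torsion objects to torsion-free objects, and every object `X` fits in
an exact sequence `0 ⟶ T ⟶ X ⟶ F ⟶ 0` with `T` torsion and `F` torsion-free (this sequence is
unique up to unique isomorphism because of the first condition). -/
structure TorsionPair (C : Type u) [Category.{v} C] [Abelian C] where
  /-- The torsion objects. -/
  torsion : ObjectProperty C
  /-- The torsion-free objects. -/
  free : ObjectProperty C
  [torsion_isClosedUnderIsomorphisms : torsion.IsClosedUnderIsomorphisms]
  [free_isClosedUnderIsomorphisms : free.IsClosedUnderIsomorphisms]
  hom_eq_zero : ∀ {T F : C}, torsion T → free F → ∀ f : T ⟶ F, f = 0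
  exists_shortExact : ∀ X : C, ∃ (T F : C) (i : T ⟶ X) (p : X ⟶ F) (zero : i ≫ p = 0),
    torsion T ∧ free F ∧ (ShortComplex.mk i p zero).ShortExact

namespace TorsionPair

variable {C : Type u} [Category.{v} C] [Abelian C] (t : TorsionPair C)

/-- The torsion pair is tilting if every object is a subobject of a torsion object. -/
def IsTilting : Prop := ∀ X : C, ∃ (T : C) (i : X ⟶ T), t.torsion T ∧ Mono i

/-- The torsion pair is cotilting if every object is a quotient of a torsion-free object. -/
def IsCotilting : Prop := ∀ X : C, ∃ (F : C) (p : F ⟶ X), t.free F ∧ Epi p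

end TorsionPair

end QuasiAbelian

end

open QuasiAbelian

noncomputable section

namespace QuasiAbelian

/-! ### Strict morphisms as regular epimorphisms and monomorphisms -/

section RegularEpiMono

variable {E : Type u} [Category.{v} E]

/-! Strict epimorphisms and monomorphisms are the regular ones, a notion that equivalences and
duality visibly respect.

Let `E` be the torsion-free class of a torsion pair in `C`. It is closed under subobjects and
extensions, and every object of `C` has a torsion-free quotient that is its reflection. Hence `E`
has kernels, computed in `C`, and cokernels, the reflections of those in `C`. A morphism is a strict
epi iff it is epi in `C`, and a strict mono iff it is mono in `C` with torsion-free cokernel.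
Pullback stability is then inherited from `C`, and pushout stability is closure under extensions
(`IsTorsionFreeEmbedding.isQuasiAbelian`). Moreover strict exactness in `E` is exactness in `C`. If
the pair is cotilting, every complex over `C`, bounded or not, is quasi-isomorphic to one over `E`,
because torsion-free resolutions of length one exist (`exists_quasiIso`). A calculus of fractions
makes `D(E) ⥤ D(C)` fully faithful, and the left heart corresponds to the complexes with cohomology
only in degree `0`, that is, to `C`.

Conversely, a quasi-abelian `E` embeds by Yoneda in abelian sheaves for the topology of strict epis.
The sheaves that are quotients of a representable by a representable form an abelian subcategory
`C`. The key point is `essImage_of_extension`: an extension of representables that embeds in a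
representable is representable, by the pushout axiom. In `C` the representables are the torsion-free
class of a cotilting pair (`exists_cotilting_of_resolutions`); the torsion-free quotient of `coker
(y f)` is `y (coker f)`.

The tilting statements follow by passing to opposite categories. -/

theorem isRegularEpi_comp_isIso_iff {X Y Z : E} (f : X ⟶ Y) (g : Y ⟶ Z) [IsIso g] :
    IsRegularEpi (f ≫ g) ↔ IsRegularEpi f :=
  (MorphismProperty.regularEpi E).cancel_right_of_respectsIso f g

theorem isRegularMono_isIso_comp_iff {X Y Z : E} (f : X ⟶ Y) (g : Y ⟶ Z) [IsIso f] :
    IsRegularMono (f ≫ g) ↔ IsRegularMono g :=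
  (MorphismProperty.regularMono E).cancel_left_of_respectsIso f g

variable [Preadditive E]

/-- A morphism killing all the morphisms killed by a regular epimorphism `f` factors through `f`. -/
theorem exists_desc_of_isRegularEpi {X Y Z : E} (f : X ⟶ Y) [IsRegularEpi f] (h : X ⟶ Z)
    (H : ∀ {W : E} (k : W ⟶ X), k ≫ f = 0 → k ≫ h = 0) : ∃ l, f ≫ l = h := by
  refine ⟨IsRegularEpi.desc f h ?_, IsRegularEpi.fac f h _⟩
  have := H (IsRegularEpi.left f - IsRegularEpi.right f)
    (by rw [Preadditive.sub_comp, IsRegularEpi.w, sub_self])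
  rwa [Preadditive.sub_comp, sub_eq_zero] at this

/-- Under these hypotheses `f` is a cokernel of `k`, that is, a coequalizer of `k` and `0`. -/
theorem isRegularEpi_of_desc {K X Y : E} (k : K ⟶ X) (f : X ⟶ Y) [Epi f] (w : k ≫ f = 0)
    (H : ∀ {Z : E} (h : X ⟶ Z), k ≫ h = 0 → ∃ l, f ≫ l = h) : IsRegularEpi f :=
  ⟨⟨{ W := K, left := k, right := 0
      w := by rw [w, zero_comp]
      isColimit := CokernelCofork.IsColimit.ofπ _ w (fun h hh => (H h hh).choose)
        (fun h hh => (H h hh).choose_spec)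
        (fun h hh m hm => by rw [← cancel_epi f, hm, (H h hh).choose_spec]) }⟩⟩

/-- A morphism killed by all the morphisms killing a regular monomorphism `f` factors
through `f`. -/
theorem exists_lift_of_isRegularMono {X Y Z : E} (f : X ⟶ Y) [IsRegularMono f] (h : Z ⟶ Y)
    (H : ∀ {W : E} (k : Y ⟶ W), f ≫ k = 0 → h ≫ k = 0) : ∃ l, l ≫ f = h := by
  obtain ⟨l, hl⟩ := exists_desc_of_isRegularEpi f.op h.op (fun {W} k hk => by
    have := H k.unop (Quiver.Hom.op_inj (by simpa using hk))
    exact Quiver.Hom.unop_inj (by simpa using this))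
  exact ⟨l.unop, Quiver.Hom.op_inj (by simpa using hl)⟩

theorem isRegularMono_of_lift {K X Y : E} (f : X ⟶ Y) (k : Y ⟶ K) [Mono f] (w : f ≫ k = 0)
    (H : ∀ {Z : E} (h : Z ⟶ Y), h ≫ k = 0 → ∃ l, l ≫ f = h) : IsRegularMono f := by
  rw [← isRegularEpi_op_iff_isRegularMono]
  refine isRegularEpi_of_desc k.op f.op (Quiver.Hom.unop_inj (by simpa using w)) ?_
  intro Z h hh
  obtain ⟨l, hl⟩ := H h.unop (Quiver.Hom.op_inj (by simpa using hh))
  exact ⟨l.op, Quiver.Hom.unop_inj (by simpa using hl)⟩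

instance isRegularEpi_cokernel_π {X Y : E} (f : X ⟶ Y) [HasCokernel f] :
    IsRegularEpi (cokernel.π f) :=
  isRegularEpi_of_desc f _ (cokernel.condition f) fun h hh => ⟨cokernel.desc f h hh, by simp⟩

instance isRegularMono_kernel_ι {X Y : E} (f : X ⟶ Y) [HasKernel f] :
    IsRegularMono (kernel.ι f) :=
  isRegularMono_of_lift _ f (kernel.condition f) fun h hh => ⟨kernel.lift f h hh, by simp⟩

/-- Two regular epimorphisms with the same source and killing the same morphisms are isomorphic. -/
theorem isIso_of_isRegularEpi_comp {X Y Z : E} (f : X ⟶ Y) (g : Y ⟶ Z) [IsRegularEpi (f ≫ g)]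
    [IsRegularEpi f] (H : ∀ {W : E} (k : W ⟶ X), k ≫ f ≫ g = 0 → k ≫ f = 0) : IsIso g := by
  obtain ⟨l, hl⟩ := exists_desc_of_isRegularEpi (f ≫ g) f (fun k hk => H k hk)
  have hf : Epi f := (IsRegularEpi.getStruct f).epi
  have hfg : Epi (f ≫ g) := (IsRegularEpi.getStruct (f ≫ g)).epi
  refine ⟨l, ?_, ?_⟩
  · rw [← cancel_epi f, ← Category.assoc, hl, Category.comp_id]
  · rw [← cancel_epi (f ≫ g), ← Category.assoc, hl, Category.comp_id]

variable [HasKernels E] [HasCokernels E]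

instance isRegularEpi_coimage_π {X Y : E} (f : X ⟶ Y) : IsRegularEpi (Abelian.coimage.π f) :=
  isRegularEpi_cokernel_π _

instance isRegularMono_image_ι {X Y : E} (f : X ⟶ Y) : IsRegularMono (Abelian.image.ι f) :=
  isRegularMono_kernel_ι _

theorem comp_coimage_π_eq_zero {W X Y : E} (f : X ⟶ Y) (k : W ⟶ X) (hk : k ≫ f = 0) :
    k ≫ Abelian.coimage.π f = 0 := by
  rw [← kernel.lift_ι f k hk, Category.assoc]
  exact (congrArg _ (cokernel.condition _)).trans comp_zero

theorem image_ι_comp_eq_zero {W X Y : E} (f : X ⟶ Y) (k : Y ⟶ W) (hk : f ≫ k = 0) :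
    Abelian.image.ι f ≫ k = 0 := by
  rw [← cokernel.π_desc f k hk, ← Category.assoc]
  exact (congrArg (· ≫ _) (kernel.condition _)).trans zero_comp

theorem isIso_image_ι {X Y : E} (f : X ⟶ Y) [Epi f] : IsIso (Abelian.image.ι f) := by
  have h0 : cokernel.π f = 0 := by rw [← cancel_epi f, cokernel.condition, comp_zero]
  have : Mono (Abelian.image.ι f) := (IsRegularMono.getStruct _).mono
  refine ⟨kernel.lift _ (𝟙 Y) (by simp [h0]), ?_, kernel.lift_ι _ _ _⟩
  rw [← cancel_mono (Abelian.image.ι f)]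
  exact (Category.assoc _ _ _).trans ((congrArg _ (kernel.lift_ι _ _ _)).trans
    ((Category.comp_id _).trans (Category.id_comp _).symm))

theorem isIso_coimage_π {X Y : E} (f : X ⟶ Y) [Mono f] : IsIso (Abelian.coimage.π f) := by
  have h0 : kernel.ι f = 0 := by rw [← cancel_mono f, kernel.condition, zero_comp]
  refine ⟨cokernel.desc _ (𝟙 X) (by simp [h0]), cokernel.π_desc _ _ _, ?_⟩
  have : Epi (Abelian.coimage.π f) := (IsRegularEpi.getStruct _).epi
  rw [← cancel_epi (Abelian.coimage.π f)]
  exact (Category.assoc _ _ _).symm.trans ((congrArg (· ≫ _) (cokernel.π_desc _ _ _)).trans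
    ((Category.id_comp _).trans (Category.comp_id _).symm))

/-- The image inclusion of an epimorphism is invertible, so strictness identifies `f` with its
coimage projection, which is a cokernel. If `f` is regular, it and its coimage projection annihilate
the same incoming morphisms, hence differ by an isomorphism. -/
theorem isStrictEpi_iff {X Y : E} (f : X ⟶ Y) : IsStrictEpi f ↔ IsRegularEpi f := by
  have key : ∀ [Epi f], IsStrict f ↔ IsRegularEpi f := by
    intro _
    have := isIso_image_ι f
    have fac := Abelian.coimage_image_factorisation f
    constructor
    · intro (h : IsIso _)
      rw [← fac, isRegularEpi_comp_isIso_iff]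
      infer_instance
    · intro h
      have : IsRegularEpi (Abelian.coimage.π f ≫
          Abelian.coimageImageComparison f ≫ Abelian.image.ι f) := by rwa [fac]
      have := isIso_of_isRegularEpi_comp (Abelian.coimage.π f)
        (Abelian.coimageImageComparison f ≫ Abelian.image.ι f) (fun k hk => by
          rw [fac] at hk
          exact comp_coimage_π_eq_zero f k hk)
      exact IsIso.of_isIso_comp_right _ (Abelian.image.ι f)
  constructor
  · rintro ⟨h₁, h₂⟩
    exact key.1 h₂
  · intro h
    have : Epi f := (IsRegularEpi.getStruct f).epi
    exact ⟨this, key.2 h⟩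

theorem isStrictMono_iff {X Y : E} (f : X ⟶ Y) : IsStrictMono f ↔ IsRegularMono f := by
  have key : ∀ [Mono f], IsStrict f ↔ IsRegularMono f := by
    intro _
    have := isIso_coimage_π f
    have fac := Abelian.coimage_image_factorisation f
    constructor
    · intro (h : IsIso _)
      rw [← fac, isRegularMono_isIso_comp_iff, isRegularMono_isIso_comp_iff]
      infer_instance
    · intro h
      have hι : Mono (Abelian.image.ι f) := (IsRegularMono.getStruct _).mono
      obtain ⟨l, hl⟩ := exists_lift_of_isRegularMono f (Abelian.image.ι f)
        (fun k hk => image_ι_comp_eq_zero f k hk)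
      have : IsIso (Abelian.coimage.π f ≫ Abelian.coimageImageComparison f) := by
        refine ⟨l, ?_, ?_⟩
        · rw [← cancel_mono f, Category.assoc, hl, Category.assoc, fac, Category.id_comp]
        · rw [← cancel_mono (Abelian.image.ι f), Category.assoc, Category.assoc, fac, hl,
            Category.id_comp]
      exact IsIso.of_isIso_comp_left (Abelian.coimage.π f) _
  constructor
  · rintro ⟨h₁, h₂⟩
    exact key.1 h₂
  · intro h
    have : Mono f := (IsRegularMono.getStruct f).mono
    exact ⟨this, key.2 h⟩

/-- A sequence is strictly exact if and only if its first morphism is a regular epimorphism onto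
the kernel of the second one. -/
theorem strictlyExact_iff (S : ShortComplex E) :
    StrictlyExact S ↔ IsRegularEpi (kernel.lift S.g S.f S.zero) := by
  let c := kernel.lift S.g (Abelian.image.ι S.f) (image_ι_comp_g_eq_zero S)
  have hc : c ≫ kernel.ι S.g = Abelian.image.ι S.f := kernel.lift_ι _ _ _
  have fac : Abelian.coimage.π S.f ≫ Abelian.coimageImageComparison S.f ≫ c =
      kernel.lift S.g S.f S.zero := by
    rw [← cancel_mono (kernel.ι S.g), kernel.lift_ι, Category.assoc, Category.assoc, hc,
      Abelian.coimage_image_factorisation]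
  constructor
  · rintro ⟨h₁ : IsIso _, h₂ : IsIso c⟩
    rw [← fac, isRegularEpi_comp_isIso_iff]
    infer_instance
  · intro h
    have hepi : Epi (kernel.lift S.g S.f S.zero) := (IsRegularEpi.getStruct _).epi
    have hι : Mono (Abelian.image.ι S.f) := (IsRegularMono.getStruct _).mono
    -- Since the lift of `S.f` is epi, `cokernel.π S.f` annihilates the whole kernel of `S.g`, which
    -- therefore maps back to the image.
    have hci : IsIso c := by
      refine ⟨kernel.lift _ (kernel.ι S.g) ?_, ?_, ?_⟩
      · rw [← cancel_epi (kernel.lift S.g S.f S.zero), ← Category.assoc, kernel.lift_ι,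
          cokernel.condition, comp_zero]
      · rw [← cancel_mono (Abelian.image.ι S.f), Category.assoc, Category.id_comp]
        exact (congrArg _ (kernel.lift_ι _ _ _)).trans hc
      · rw [← cancel_mono (kernel.ι S.g), Category.assoc, hc, Category.id_comp]
        exact kernel.lift_ι _ _ _
    refine ⟨?_, hci⟩
    have : IsRegularEpi (Abelian.coimage.π S.f ≫ Abelian.coimageImageComparison S.f ≫ c) := by
      rwa [fac]
    have := isIso_of_isRegularEpi_comp (Abelian.coimage.π S.f)
      (Abelian.coimageImageComparison S.f ≫ c) (fun k hk => by
        refine comp_coimage_π_eq_zero S.f k ?_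
        rw [fac] at hk
        rw [← kernel.lift_ι S.g S.f S.zero, ← Category.assoc, hk, zero_comp])
    exact IsIso.of_isIso_comp_right (Abelian.coimageImageComparison S.f) c

end RegularEpiMono

/-! ### Regular epimorphisms under equivalences. -/

section Equivalence

variable {E : Type u} [Category.{v} E] {E' : Type w} [Category.{w'} E'] (e : E ≌ E')

instance IsRegularEpi.map_equivalence {X Y : E} (f : X ⟶ Y) [IsRegularEpi f] :
    IsRegularEpi (e.functor.map f) := by
  let s := IsRegularEpi.getStruct f
  exact ⟨⟨{ W := _, left := e.functor.map s.left, right := e.functor.map s.right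
            w := by rw [← Functor.map_comp, s.w, Functor.map_comp]
            isColimit := isColimitCoforkMapOfIsColimit e.functor s.w s.isColimit }⟩⟩

theorem IsRegularEpi.of_map_equivalence {X Y : E} (f : X ⟶ Y) [IsRegularEpi (e.functor.map f)] :
    IsRegularEpi f := by
  have : IsRegularEpi (e.inverse.map (e.functor.map f)) :=
    IsRegularEpi.map_equivalence e.symm (e.functor.map f)
  exact ((MorphismProperty.regularEpi E).arrow_mk_iso_iff
    (((Functor.mapArrowFunctor _ _).mapIso e.unitIso).app (Arrow.mk f))).2 this

end Equivalence

/-! ### Quasi-abelian categories: characterization, duality and transport -/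

section Characterization

variable {E : Type u} [Category.{v} E] [Preadditive E] [HasZeroObject E] [HasBinaryBiproducts E]

theorem isQuasiAbelian_of_isRegularEpi [HasKernels E] [HasCokernels E]
    (h₁ : ∀ {P X Y Z : E} {fst : P ⟶ X} {snd : P ⟶ Y} {f : X ⟶ Z} {g : Y ⟶ Z},
      IsPullback fst snd f g → IsRegularEpi g → IsRegularEpi fst)
    (h₂ : ∀ {Z X Y P : E} {f : Z ⟶ X} {g : Z ⟶ Y} {inl : X ⟶ P} {inr : Y ⟶ P},
      IsPushout f g inl inr → IsRegularMono f → IsRegularMono inr) : IsQuasiAbelian E where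
  isStrictEpi_of_isPullback sq hg := (isStrictEpi_iff _).2 (h₁ sq ((isStrictEpi_iff _).1 hg))
  isStrictMono_of_isPushout sq hf := (isStrictMono_iff _).2 (h₂ sq ((isStrictMono_iff _).1 hf))

theorem isRegularEpi_of_isPullback [IsQuasiAbelian E] {P X Y Z : E} {fst : P ⟶ X} {snd : P ⟶ Y}
    {f : X ⟶ Z} {g : Y ⟶ Z} (sq : IsPullback fst snd f g) [hg : IsRegularEpi g] :
    IsRegularEpi fst :=
  (isStrictEpi_iff _).1 (IsQuasiAbelian.isStrictEpi_of_isPullback sq ((isStrictEpi_iff _).2 hg))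

theorem isRegularMono_of_isPushout [IsQuasiAbelian E] {Z X Y P : E} {f : Z ⟶ X} {g : Z ⟶ Y}
    {inl : X ⟶ P} {inr : Y ⟶ P} (sq : IsPushout f g inl inr) [hf : IsRegularMono f] :
    IsRegularMono inr :=
  (isStrictMono_iff _).1 (IsQuasiAbelian.isStrictMono_of_isPushout sq ((isStrictMono_iff _).2 hf))

theorem IsQuasiAbelian.op [IsQuasiAbelian E] : IsQuasiAbelian Eᵒᵖ :=
  isQuasiAbelian_of_isRegularEpi
    (fun sq hg => by
      have : IsRegularMono _ := (isRegularMono_unop_iff_isRegularEpi _).2 hg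
      exact (isRegularMono_unop_iff_isRegularEpi _).1 (isRegularMono_of_isPushout sq.unop))
    (fun sq hf => by
      have : IsRegularEpi _ := (isRegularEpi_unop_iff_isRegularMono _).2 hf
      exact (isRegularEpi_unop_iff_isRegularMono _).1 (isRegularEpi_of_isPullback sq.unop))

theorem IsQuasiAbelian.of_equivalence {E' : Type w} [Category.{w'} E'] [Preadditive E']
    [HasZeroObject E'] [HasBinaryBiproducts E'] [IsQuasiAbelian E] (e : E ≌ E') :
    IsQuasiAbelian E' := by
  have : HasEqualizers E := Preadditive.hasEqualizers_of_hasKernels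
  have : HasCoequalizers E := Preadditive.hasCoequalizers_of_hasCokernels
  have : HasEqualizers E' := Adjunction.hasLimitsOfShape_of_equivalence e.inverse
  have : HasCoequalizers E' := Adjunction.hasColimitsOfShape_of_equivalence e.inverse
  refine isQuasiAbelian_of_isRegularEpi (fun {P X Y Z fst snd f g} sq hg => ?_)
    (fun {Z X Y P f g inl inr} sq hf => ?_)
  · have : IsRegularEpi (e.inverse.map g) := IsRegularEpi.map_equivalence e.symm g
    have : IsRegularEpi (e.symm.functor.map fst) := isRegularEpi_of_isPullback (sq.map e.inverse)
    exact IsRegularEpi.of_map_equivalence e.symm fst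
  -- Regular monomorphisms are transported as regular epimorphisms of the opposite categories.
  · have := IsRegularEpi.map_equivalence e.op.symm f.op
    have : IsRegularMono (e.inverse.map f) := (isRegularEpi_op_iff_isRegularMono _).1 this
    have := isRegularMono_of_isPushout (sq.map e.inverse)
    have : IsRegularEpi (e.op.symm.functor.map inr.op) :=
      (isRegularEpi_op_iff_isRegularMono _).2 this
    have := IsRegularEpi.of_map_equivalence e.op.symm inr.op
    exact (isRegularEpi_op_iff_isRegularMono _).1 this

end Characterization

/-! ### Embeddings as a torsion-free class -/

section Embedding

variable {E : Type u} [Category.{v} E] [Preadditive E]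
  {C : Type w} [Category.{w'} C] [Abelian C]

/-- The essential image of `i : E ⥤ C` is closed under subobjects and extensions, and every object
has an epimorphic reflection in it. This holds for the embedding of a torsion-free class. -/
structure IsTorsionFreeEmbedding (i : E ⥤ C) : Prop where
  of_mono : ∀ {A : C} {X : E} (m : A ⟶ i.obj X) [Mono m], i.essImage A
  of_shortExact : ∀ {S : ShortComplex C}, S.ShortExact → i.essImage S.X₁ → i.essImage S.X₃ →
    i.essImage S.X₂
  exists_reflection : ∀ A : C, ∃ (X : E) (r : A ⟶ i.obj X), Epi r ∧
    ∀ {Z : E} (φ : A ⟶ i.obj Z), ∃ ψ, r ≫ ψ = φ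

namespace IsTorsionFreeEmbedding

variable {i : E ⥤ C} [i.Full] [i.Faithful] [i.Additive] (hi : IsTorsionFreeEmbedding i)

include hi

/-- The kernel taken in `C` is a subobject of `i.obj X`, so it already lies in the essential image.
-/
theorem exists_isLimit_kernelFork {X Y : E} (f : X ⟶ Y) :
    ∃ (c : KernelFork f), Nonempty (IsLimit c) ∧ Nonempty (IsLimit (i.mapCone c)) := by
  obtain ⟨K, ⟨e⟩⟩ := hi.of_mono (kernel.ι (i.map f))
  let k : K ⟶ X := i.preimage (e.hom ≫ kernel.ι (i.map f))
  have hk : i.map k = e.hom ≫ kernel.ι (i.map f) := i.map_preimage _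
  have w : k ≫ f = 0 := i.map_injective (by simp [hk])
  have hl : IsLimit (i.mapCone (KernelFork.ofι k w)) := by
    refine (KernelFork.isLimitMapConeEquiv _ _).symm ?_
    exact IsLimit.ofIsoLimit (kernelIsKernel (i.map f)) (Fork.ext e.symm (by
      change e.inv ≫ i.map k = kernel.ι (i.map f)
      rw [hk, e.inv_hom_id_assoc]))
  exact ⟨KernelFork.ofι k w, ⟨isLimitOfReflects i hl⟩, ⟨hl⟩⟩

theorem hasKernels : HasKernels E where
  has_limit f := by
    obtain ⟨c, ⟨hc⟩, _⟩ := hi.exists_isLimit_kernelFork f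
    exact ⟨⟨_, hc⟩⟩

theorem preservesKernel {X Y : E} (f : X ⟶ Y) : PreservesLimit (parallelPair f 0) i := by
  obtain ⟨c, ⟨hc⟩, ⟨hc'⟩⟩ := hi.exists_isLimit_kernelFork f
  exact preservesLimit_of_preserves_limit_cone hc hc'

/-- The cokernel in `E` is the reflection of the cokernel in `C`; `i` need not preserve it. -/
theorem hasCokernels : HasCokernels E where
  has_colimit {X Y} f := by
    obtain ⟨Q, r, hr, H⟩ := hi.exists_reflection (cokernel (i.map f))
    let q : Y ⟶ Q := i.preimage (cokernel.π (i.map f) ≫ r)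
    have hq : i.map q = cokernel.π (i.map f) ≫ r := i.map_preimage _
    have w : f ≫ q = 0 := i.map_injective (by simp [hq])
    have : Epi q := i.epi_of_epi_map (by rw [hq]; infer_instance)
    have H' : ∀ {Z : E} (h : Y ⟶ Z), f ≫ h = 0 → ∃ l, q ≫ l = h := by
      intro Z h hh
      obtain ⟨ψ, hψ⟩ := H (cokernel.desc (i.map f) (i.map h) (by rw [← i.map_comp, hh, i.map_zero]))
      exact ⟨i.preimage ψ, i.map_injective (by simp [hq, hψ])⟩
    exact ⟨⟨_, CokernelCofork.IsColimit.ofπ q w (fun h hh => (H' h hh).choose)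
      (fun h hh => (H' h hh).choose_spec)
      (fun h hh m hm => by rw [← cancel_epi q, hm, (H' h hh).choose_spec])⟩⟩

theorem preservesFiniteLimits [HasZeroObject E] [HasBinaryBiproducts E] :
    PreservesFiniteLimits i := by
  have := hi.hasKernels
  have {X Y : E} (f : X ⟶ Y) := hi.preservesKernel f
  have : HasEqualizers E := Preadditive.hasEqualizers_of_hasKernels
  have : HasFiniteProducts E := hasFiniteProducts_of_has_binary_and_terminal
  exact i.preservesFiniteLimits_of_preservesKernels

/-- The image of `i.map f` lies in `E`, being a subobject of `i.obj Y`. A regular epi extends its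
factor onto that image to a section of the inclusion, which is thus invertible. Conversely, an epi
of `C` is the cokernel of its kernel, and this kernel comes from `E`. -/
theorem isRegularEpi_iff {X Y : E} (f : X ⟶ Y) : IsRegularEpi f ↔ Epi (i.map f) := by
  have := hi.hasKernels
  have := hi.preservesKernel f
  constructor
  · intro h
    have hf : Epi f := (IsRegularEpi.getStruct f).epi
    obtain ⟨I, ⟨a⟩⟩ := hi.of_mono (Abelian.image.ι (i.map f))
    let m : I ⟶ Y := i.preimage (a.hom ≫ Abelian.image.ι (i.map f))
    let p : X ⟶ I := i.preimage (Abelian.factorThruImage (i.map f) ≫ a.inv)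
    have hpm : p ≫ m = f := i.map_injective (by simp [p, m])
    have hm : Mono (i.map m) := by simp only [m, i.map_preimage]; infer_instance
    have hm' : Mono m := i.mono_of_mono_map hm
    obtain ⟨l, hl⟩ := exists_desc_of_isRegularEpi f p (fun k hk => by
      rw [← cancel_mono m, Category.assoc, hpm, hk, zero_comp])
    have hlm : l ≫ m = 𝟙 Y := by rw [← cancel_epi f, ← Category.assoc, hl, hpm, Category.comp_id]
    have : IsSplitEpi (i.map m) := ⟨⟨i.map l, by rw [← i.map_comp, hlm, i.map_id]⟩⟩
    have hp : Epi (i.map p) := by simp only [p, i.map_preimage]; infer_instance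
    rw [← hpm, i.map_comp]
    infer_instance
  · intro h
    have : Epi f := i.epi_of_epi_map h
    refine isRegularEpi_of_desc (kernel.ι f) f (kernel.condition f) (fun {Z} g hg => ?_)
    have hc := Abelian.epiIsCokernelOfKernel _
      (isLimitForkMapOfIsLimit' i (kernel.condition f) (kernelIsKernel f))
    obtain ⟨l, hl⟩ := CokernelCofork.IsColimit.desc' hc (i.map g)
      (by change i.map _ ≫ _ = 0; rw [← i.map_comp, hg, i.map_zero])
    exact ⟨i.preimage l, i.map_injective (by simpa using hl)⟩

/-- A regular mono is the kernel of its cokernel in `E`. As `i` preserves this kernel, the cokernel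
in `C` embeds in an object of `E`, hence lies in the essential image. Conversely, a mono of `C` is
the kernel of its cokernel. -/
theorem isRegularMono_iff {X Y : E} (f : X ⟶ Y) :
    IsRegularMono f ↔ Mono (i.map f) ∧ i.essImage (cokernel (i.map f)) := by
  constructor
  · intro h
    have := hi.hasCokernels
    have hf : Mono f := (IsRegularMono.getStruct f).mono
    have := hi.hasKernels
    have := hi.preservesKernel (cokernel.π f)
    have L : ∀ {W : E} (g : W ⟶ Y), g ≫ cokernel.π f = 0 → ∃ l, l ≫ f = g := fun g hg =>
      exists_lift_of_isRegularMono f g (fun k hk => by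
        rw [← cokernel.π_desc f k hk, ← Category.assoc, hg, zero_comp])
    have hl : IsLimit (KernelFork.ofι f (cokernel.condition f)) :=
      KernelFork.IsLimit.ofι _ _ (fun g hg => (L g hg).choose) (fun g hg => (L g hg).choose_spec)
        (fun g hg m hm => by rw [← cancel_mono f, hm, (L g hg).choose_spec])
    have hl' := isLimitForkMapOfIsLimit' i _ hl
    have hm : Mono (i.map f) := mono_of_isLimit_fork hl'
    refine ⟨hm, ?_⟩
    have w : i.map f ≫ i.map (cokernel.π f) = 0 := by
      rw [← i.map_comp, cokernel.condition, i.map_zero]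
    have he := (ShortComplex.mk _ _ w).exact_of_f_is_kernel hl'
    have : Mono (cokernel.desc _ _ w) := (ShortComplex.exact_iff_mono_cokernel_desc _).1 he
    exact hi.of_mono (cokernel.desc _ _ w)
  · rintro ⟨hm, W, ⟨e⟩⟩
    let g : Y ⟶ W := i.preimage (cokernel.π (i.map f) ≫ e.inv)
    have hg : i.map g = cokernel.π (i.map f) ≫ e.inv := i.map_preimage _
    have : Mono f := i.mono_of_mono_map hm
    refine isRegularMono_of_lift f g (i.map_injective (by simp [hg])) (fun {Z} h hh => ?_)
    obtain ⟨l, hl⟩ := KernelFork.IsLimit.lift' (Abelian.monoIsKernelOfCokernel _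
      (cokernelIsCokernel (i.map f))) (i.map h) (by
        change _ ≫ cokernel.π (i.map f) = 0
        rw [← cancel_mono e.inv, zero_comp, Category.assoc, ← hg, ← i.map_comp, hh, i.map_zero])
    exact ⟨i.preimage l, i.map_injective (by simpa using hl)⟩

/-- Pullbacks are computed in `C`, where epis are stable. The pushout in `C` of a strict mono is an
extension of its cokernel by `i.obj Y`, so it lies in the essential image and agrees with the
pushout in `E`; the cokernel is unchanged. -/
theorem isQuasiAbelian [HasZeroObject E] [HasBinaryBiproducts E] : IsQuasiAbelian E := by
  have := hi.hasKernels
  have := hi.hasCokernels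
  have := hi.preservesFiniteLimits
  refine isQuasiAbelian_of_isRegularEpi (fun {P X Y Z fst snd f g} sq hg => ?_)
    (fun {Z X Y P f g inl inr} sq hf => ?_)
  · rw [hi.isRegularEpi_iff] at hg ⊢
    exact (MorphismProperty.epimorphisms C).of_isPullback (sq.map i).flip hg
  · rw [hi.isRegularMono_iff] at hf ⊢
    obtain ⟨hf, hf'⟩ := hf
    let S : ShortComplex C := ShortComplex.mk (pushout.inr (i.map f) (i.map g))
      (pushout.desc (cokernel.π (i.map f)) 0 (by rw [cokernel.condition, comp_zero]))
      (pushout.inr_desc _ _ _)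
    have hmono : Mono S.f := inferInstanceAs (Mono (pushout.inr (i.map f) (i.map g)))
    have hepi : Epi S.g := epi_of_epi_fac (pushout.inl_desc _ _ _)
    have hc : IsColimit (CokernelCofork.ofπ S.g S.zero) :=
      CokernelCofork.IsColimit.ofπ' _ _ (fun {A} k hk => ⟨cokernel.desc (i.map f)
        (pushout.inl _ _ ≫ k) (by
          rw [pushout.condition_assoc]
          exact (congrArg _ hk).trans comp_zero), by
        apply pushout.hom_ext
        · rw [pushout.inl_desc_assoc, cokernel.π_desc]
        · rw [pushout.inr_desc_assoc, zero_comp]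
          exact hk.symm⟩)
    have hS : S.ShortExact := { exact := S.exact_of_g_is_cokernel hc }
    obtain ⟨P', ⟨e⟩⟩ := hi.of_shortExact hS ⟨Y, ⟨Iso.refl _⟩⟩ hf'
    have sq' : IsPushout f g (i.preimage (pushout.inl (i.map f) (i.map g) ≫ e.inv))
        (i.preimage (pushout.inr (i.map f) (i.map g) ≫ e.inv)) := by
      refine IsPushout.of_map i (i.map_injective (by simp [pushout.condition_assoc])) ?_
      simp only [i.map_preimage]
      exact (IsPushout.of_hasPushout (i.map f) (i.map g)).of_iso (Iso.refl _) (Iso.refl _)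
        (Iso.refl _) e.symm (by simp) (by simp) (by simp) (by simp)
    have hinr : i.map inr = S.f ≫ e.inv ≫ i.map (sq'.isoIsPushout _ _ sq).hom := by
      refine (congrArg i.map (sq'.inr_isoIsPushout_hom _ _ sq)).symm.trans ?_
      rw [i.map_comp, i.map_preimage, Category.assoc]
    rw [hinr]
    refine ⟨inferInstance, ?_⟩
    exact i.essImage.prop_of_iso ((hc.coconePointUniqueUpToIso (cokernelIsCokernel S.f)).trans
      (cokernelCompIsIso S.f (e.inv ≫ i.map (sq'.isoIsPushout _ _ sq).hom)).symm) hf'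

/-- Both sides say that the first morphism covers the kernel of the second; `i` preserves that
kernel and turns regular epis into epis. -/
theorem strictlyExact_iff [HasKernels E] [HasCokernels E] (S : ShortComplex E) :
    StrictlyExact S ↔ (S.map i).Exact := by
  have := hi.preservesKernel S.g
  rw [QuasiAbelian.strictlyExact_iff, hi.isRegularEpi_iff, ShortComplex.exact_iff_epi_kernel_lift]
  have fac : i.map (kernel.lift S.g S.f S.zero) ≫ (PreservesKernel.iso i S.g).hom =
      kernel.lift (S.map i).g (S.map i).f (S.map i).zero := by
    refine (cancel_mono (kernel.ι (i.map S.g))).1 ?_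
    rw [Category.assoc, PreservesKernel.iso_hom]
    refine (congrArg _ (kernelComparison_comp_ι S.g i)).trans ?_
    rw [← i.map_comp, kernel.lift_ι]
    exact (kernel.lift_ι _ _ _).symm
  rw [← fac]
  exact ((MorphismProperty.epimorphisms C).cancel_right_of_respectsIso _
    (PreservesKernel.iso i S.g).hom).symm

end IsTorsionFreeEmbedding

end Embedding

/-! ### Resolutions of unbounded complexes -/

section Resolution

open CochainComplex HomComplex

variable {E : Type u} [Category.{v} E] [Preadditive E]
  {C : Type w} [Category.{w'} C] [Abelian C]

theorem exists_mapHomologicalComplex_iso (i : E ⥤ C) [i.Full] [i.Faithful] [i.Additive]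
    (M : CochainComplex C ℤ) (hM : ∀ n, i.essImage (M.X n)) :
    ∃ L : CochainComplex E ℤ,
      Nonempty ((i.mapHomologicalComplex (ComplexShape.up ℤ)).obj L ≅ M) := by
  choose X e using fun n => (hM n)
  replace e := fun n => (e n).some
  let L : CochainComplex E ℤ :=
    { X := X
      d := fun p q => i.preimage ((e p).hom ≫ M.d p q ≫ (e q).inv)
      shape := fun p q h => i.map_injective (by simp [M.shape p q h])
      d_comp_d' := fun p q r _ _ => i.map_injective (by simp) }
  exact ⟨L, ⟨HomologicalComplex.Hom.isoOfComponents (fun n => e n) (fun p q _ => by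
    change (e p).hom ≫ M.d p q = i.map (i.preimage _) ≫ (e q).hom
    rw [i.map_preimage, Category.assoc, Category.assoc, (e q).inv_hom_id, Category.comp_id])⟩⟩

/-- Any complex is a degreewise epimorphic image of a complex with terms isomorphic to
`F (n + 1) ⊞ F n`, where the objects `F n` can be chosen arbitrarily among those with
an epimorphism to `K (n - 1)`. -/
theorem exists_epi_of_generators (P : ObjectProperty C)
    (hP : ∀ A : C, ∃ (F : C) (p : F ⟶ A), P F ∧ Epi p)
    (hP' : ∀ {A B : C}, P A → P B → P (A ⊞ B)) [P.IsClosedUnderIsomorphisms]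
    (K : CochainComplex C ℤ) :
    ∃ (T : CochainComplex C ℤ) (f : T ⟶ K), (∀ n, P (T.X n)) ∧ ∀ n, Epi (f.f n) := by
  -- A map from the cone of `𝟙 G` is an arbitrary degree `-1` cochain `α`, together with its
  -- coboundary `β`. The component `G^(n+1) ⟶ K^n` of `α` must be epi, whence the shift in `n - 1`.
  choose F p hF hp using fun n => hP (K.X (n - 1))
  let G : CochainComplex C ℤ := { X := F, d := fun _ _ => 0 }
  let α : Cochain G K (-1) := Cochain.mk fun a b h =>
    p a ≫ (K.XIsoOfEq (show a - 1 = b by lia)).hom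
  let β : G ⟶ K := Cocycle.homOf (Cocycle.mk (δ (-1) 0 α) 1 (by simp) (δ_δ _ _ _ _))
  refine ⟨mappingCone (𝟙 G), mappingCone.desc (𝟙 G) α β (by simp [β]), fun n => ?_, fun n => ?_⟩
  · exact P.prop_of_iso (HomologicalComplex.homotopyCofiber.XIsoBiprod (𝟙 G) n (n + 1) rfl).symm
      (hP' (hF _) (hF _))
  · have : Epi (α.v (n + 1) n (by lia)) := by
      dsimp only [α]
      rw [Cochain.mk_v]
      infer_instance
    exact epi_of_epi_fac (mappingCone.inl_v_desc_f (𝟙 G) α β _ (n + 1) n _)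

/-- For a degreewise epi `T ⟶ K` with terms of `T` from `E`, the kernel also has terms from `E`, by
closure under subobjects. The cone of `kernel ⟶ T` is then quasi-isomorphic to `K`. As two steps
suffice, no boundedness is needed. -/
theorem IsTorsionFreeEmbedding.exists_quasiIso [HasZeroObject E] [HasBinaryBiproducts E]
    {i : E ⥤ C} [i.Full] [i.Faithful] [i.Additive] (hi : IsTorsionFreeEmbedding i)
    (hi' : ∀ A : C, ∃ (X : E) (p : i.obj X ⟶ A), Epi p) (K : CochainComplex C ℤ) :
    ∃ (L : CochainComplex E ℤ) (f : (i.mapHomologicalComplex (ComplexShape.up ℤ)).obj L ⟶ K),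
      QuasiIso f := by
  have hbiprod : ∀ {A B : C}, i.essImage A → i.essImage B → i.essImage (A ⊞ B) := by
    rintro A B ⟨X, ⟨a⟩⟩ ⟨Y, ⟨b⟩⟩
    have := preservesBinaryBiproducts_of_preservesBiproducts i
    exact ⟨X ⊞ Y, ⟨i.mapBiprod X Y ≪≫ biprod.mapIso a b⟩⟩
  obtain ⟨T, f, hT, hf⟩ := exists_epi_of_generators i.essImage (fun A => by
    obtain ⟨X, p, hp⟩ := hi' A
    exact ⟨_, p, i.obj_mem_essImage X, hp⟩) hbiprod K
  have : Epi f := HomologicalComplex.epi_of_epi_f f hf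
  let S : ShortComplex (CochainComplex C ℤ) := ShortComplex.mk (kernel.ι f) f (kernel.condition f)
  have hS : S.ShortExact := { exact := ShortComplex.exact_kernel f }
  have hN : ∀ n, i.essImage ((kernel f).X n) := fun n => by
    obtain ⟨X, ⟨e⟩⟩ := hT n
    have : Mono ((kernel.ι f).f n) := inferInstance
    exact hi.of_mono ((kernel.ι f).f n ≫ e.inv)
  obtain ⟨L, ⟨e⟩⟩ := exists_mapHomologicalComplex_iso i (mappingCone S.f) (fun n =>
    i.essImage.prop_of_iso (HomologicalComplex.homotopyCofiber.XIsoBiprod S.f n (n + 1) rfl).symm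
      (hbiprod (hN _) (hT _)))
  have := mappingCone.quasiIso_descShortComplex hS
  exact ⟨L, e.hom ≫ mappingCone.descShortComplex S, inferInstance⟩

end Resolution

/-! ### Localization of full subcategories admitting resolutions -/

section Localization

variable {K : Type*} [Category* K] {K' : Type*} [Category* K'] {D : Type*} [Category* D]
  {D' : Type*} [Category* D'] (F : K ⥤ K') [F.Full]
  (W : MorphismProperty K) (W' : MorphismProperty K') (hW : W = W'.inverseImage F)
  [W'.HasRightCalculusOfFractions]
  (L : K ⥤ D) [L.IsLocalization W] (L' : K' ⥤ D') [L'.IsLocalization W']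
  (G : D ⥤ D') (e : L ⋙ G ≅ F ⋙ L')
  (hF : ∀ Y : K', ∃ (X : K) (s : F.obj X ⟶ Y), W' s)

include hW e hF

/-- Write a morphism of `D'` as a right fraction and refine its apex to an object `F.obj X'`.
Fullness of `F` lifts both legs to `K`, and `hW` puts the denominator in `W`. -/
theorem full_of_resolutions : G.Full := by
  have : L.EssSurj := Localization.essSurj L W
  refine G.full_of_comp_essSurj L (fun X Y φ => ?_)
  obtain ⟨φ', hφ'⟩ : ∃ φ', φ' = e.inv.app X ≫ φ ≫ e.hom.app Y := ⟨_, rfl⟩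
  obtain ⟨z, hz⟩ := Localization.exists_rightFraction L' W' φ'
  obtain ⟨X', t, ht⟩ := hF z.X'
  obtain ⟨s, hs⟩ := F.map_surjective (t ≫ z.s)
  obtain ⟨a, ha⟩ := F.map_surjective (t ≫ z.f)
  have hsW : W s := by
    rw [hW, MorphismProperty.inverseImage_iff, hs]
    exact W'.comp_mem _ _ ht z.hs
  have := Localization.inverts L W s hsW
  refine ⟨inv (L.map s) ≫ L.map a, ?_⟩
  rw [← cancel_epi (G.map (L.map s)), ← G.map_comp, IsIso.hom_inv_id_assoc,
    ← cancel_mono (e.hom.app Y)]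
  have h1 := e.hom.naturality a
  have h2 := e.hom.naturality s
  dsimp at h1 h2
  have h3 : φ ≫ e.hom.app Y = e.hom.app X ≫ φ' := by simp [hφ']
  rw [h1, Category.assoc, h3, reassoc_of% h2, ha, hs, hz]
  simp

/-- After reduction to a common denominator, two numerators with the same image in `D'` are
equalized by a morphism of `W'`, which can be refined to one coming from `W`. -/
theorem faithful_of_resolutions [F.Faithful] [W.HasRightCalculusOfFractions] : G.Faithful := by
  have : L.EssSurj := Localization.essSurj L W
  refine G.faithful_of_comp_essSurj L (fun X Y f g hfg => ?_)
  obtain ⟨z, hz⟩ := Localization.exists_rightFraction L W f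
  obtain ⟨z', hz'⟩ := Localization.exists_rightFraction L W (L.map z.s ≫ g)
  have := Localization.inverts L W z.s z.hs
  have := Localization.inverts L W z'.s z'.hs
  have hf : L.map z'.s ≫ L.map z.s ≫ f = L.map (z'.s ≫ z.f) := by simp [hz]
  have hg : L.map z'.s ≫ L.map z.s ≫ g = L.map z'.f := by simp [hz']
  rw [← cancel_epi (L.map z.s), ← cancel_epi (L.map z'.s), hf, hg]
  have key : L'.map (F.map (z'.s ≫ z.f)) = L'.map (F.map z'.f) := by
    have h1 := e.hom.naturality (z'.s ≫ z.f)
    have h2 := e.hom.naturality z'.f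
    dsimp only [Functor.comp_map] at h1 h2
    rw [← cancel_epi (e.hom.app _), ← h1, ← h2, ← hf, ← hg]
    simp only [Functor.map_comp, hfg]
  rw [MorphismProperty.map_eq_iff_precomp L' W'] at key
  obtain ⟨Z, s, hs, fac⟩ := key
  obtain ⟨X', t, ht⟩ := hF Z
  obtain ⟨u, hu⟩ := F.map_surjective (t ≫ s)
  have huW : W u := hW.ge _ (by
    rw [MorphismProperty.inverseImage_iff, hu]
    exact W'.comp_mem _ _ ht hs)
  have := Localization.inverts L W u huW
  rw [← cancel_epi (L.map u), ← L.map_comp, ← L.map_comp]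
  congr 1
  apply F.map_injective
  rw [F.map_comp u, F.map_comp u, hu, Category.assoc, Category.assoc, fac]

end Localization

/-! ### The left heart and the ambient abelian category of a cotilting torsion pair -/

section LeftHeartEquivalence

variable {E : Type u} [Category.{v} E] [Preadditive E] [HasZeroObject E] [HasBinaryBiproducts E]
  [HasKernels E] [HasCokernels E] {C : Type w} [Category.{w'} C] [Abelian C]

namespace IsTorsionFreeEmbedding

variable {i : E ⥤ C} [i.Full] [i.Faithful] [i.Additive] (hi : IsTorsionFreeEmbedding i)

include hi

omit [HasZeroObject E] [HasBinaryBiproducts E] in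
theorem strictlyExactAt_iff (K : CochainComplex E ℤ) (n : ℤ) :
    StrictlyExactAt K n ↔ ((i.mapHomologicalComplex (ComplexShape.up ℤ)).obj K).ExactAt n := by
  rw [StrictlyExactAt, hi.strictlyExact_iff]
  rfl

omit [HasZeroObject E] [HasBinaryBiproducts E] in
theorem acyclic_eq_inverseImage :
    acyclic E = (HomotopyCategory.subcategoryAcyclic C).inverseImage
      (i.mapHomotopyCategory (ComplexShape.up ℤ)) := by
  have key : ∀ K : CochainComplex E ℤ, (∀ n, StrictlyExactAt K n) ↔
      HomotopyCategory.subcategoryAcyclic C ((i.mapHomotopyCategory (ComplexShape.up ℤ)).obj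
        ((HomotopyCategory.quotient E (ComplexShape.up ℤ)).obj K)) := fun K => by
    simp only [hi.strictlyExactAt_iff]
    exact (HomotopyCategory.quotient_obj_mem_subcategoryAcyclic_iff_exactAt _).symm
  ext X
  constructor
  · rintro ⟨L, hL, ⟨e⟩⟩
    exact ((HomotopyCategory.subcategoryAcyclic C).inverseImage
      (i.mapHomotopyCategory (ComplexShape.up ℤ))).prop_of_iso e ((key L).1 hL)
  · intro hX
    obtain ⟨K, rfl⟩ := HomotopyCategory.quotient_obj_surjective X
    exact ⟨K, (key K).2 hX, ⟨Iso.refl _⟩⟩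

theorem trW_acyclic_eq_inverseImage :
    (acyclic E).trW = (HomotopyCategory.subcategoryAcyclic C).trW.inverseImage
      (i.mapHomotopyCategory (ComplexShape.up ℤ)) := by
  ext X Y f
  rw [hi.acyclic_eq_inverseImage, ObjectProperty.inverseImage_trW_iff,
    MorphismProperty.inverseImage_iff]

theorem isInvertedBy [HasDerivedCategory C] : (acyclic E).trW.IsInvertedBy
    (i.mapHomotopyCategory (ComplexShape.up ℤ) ⋙ DerivedCategory.Qh) := fun X Y f hf => by
  rw [hi.trW_acyclic_eq_inverseImage] at hf
  exact Localization.inverts DerivedCategory.Qh (HomotopyCategory.subcategoryAcyclic C).trW _ hf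

/-- The functor between derived categories induced by the embedding `i`. -/
def derFunctor [HasDerivedCategory C] : DerCat E ⥤ DerivedCategory C :=
  Localization.lift _ hi.isInvertedBy (acyclic E).trW.Q

/-- The compatibility of the functor between derived categories with the localization functors. -/
def derFunctorFac [HasDerivedCategory C] : (acyclic E).trW.Q ⋙ hi.derFunctor ≅
    i.mapHomotopyCategory (ComplexShape.up ℤ) ⋙ DerivedCategory.Qh :=
  Localization.fac _ hi.isInvertedBy (acyclic E).trW.Q

/-- The compatibility of the functor between derived categories with the functors from
the categories of complexes. -/
def toDerCatCompDerFunctor [HasDerivedCategory C] : toDerCat E ⋙ hi.derFunctor ≅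
    i.mapHomologicalComplex (ComplexShape.up ℤ) ⋙ DerivedCategory.Q :=
  Functor.associator _ _ _ ≪≫ Functor.isoWhiskerLeft _ hi.derFunctorFac ≪≫
    (Functor.associator _ _ _).symm ≪≫
    Functor.isoWhiskerRight (i.mapHomotopyCategoryFactors (ComplexShape.up ℤ)) _ ≪≫
    Functor.associator _ _ _ ≪≫
    Functor.isoWhiskerLeft _ (DerivedCategory.quotientCompQhIso C)

variable (hi' : ∀ A : C, ∃ (X : E) (p : i.obj X ⟶ A), Epi p)

include hi'

omit [HasKernels E] [HasCokernels E] in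
theorem exists_trW (Y : HomotopyCategory C (ComplexShape.up ℤ)) :
    ∃ (X : HoCat E) (s : (i.mapHomotopyCategory (ComplexShape.up ℤ)).obj X ⟶ Y),
      (HomotopyCategory.subcategoryAcyclic C).trW s := by
  obtain ⟨K, rfl⟩ := HomotopyCategory.quotient_obj_surjective Y
  obtain ⟨L, f, hf⟩ := hi.exists_quasiIso hi' K
  refine ⟨(HomotopyCategory.quotient E (ComplexShape.up ℤ)).obj L,
    (HomotopyCategory.quotient C (ComplexShape.up ℤ)).map f, ?_⟩
  rw [← HomotopyCategory.quasiIso_eq_trW_subcategoryAcyclic]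
  exact (HomotopyCategory.quotient_map_mem_quasiIso_iff f).2 hf

theorem full_derFunctor [HasDerivedCategory C] : hi.derFunctor.Full :=
  full_of_resolutions _ _ _ hi.trW_acyclic_eq_inverseImage _ DerivedCategory.Qh _
    hi.derFunctorFac (hi.exists_trW hi')

theorem faithful_derFunctor [HasDerivedCategory C] : hi.derFunctor.Faithful := by
  have : (acyclic E).trW.HasRightCalculusOfFractions := by
    rw [hi.acyclic_eq_inverseImage]
    infer_instance
  exact faithful_of_resolutions _ _ _ hi.trW_acyclic_eq_inverseImage _ DerivedCategory.Qh _
    hi.derFunctorFac (hi.exists_trW hi')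

omit hi' in
theorem isLE_derFunctor_obj [HasDerivedCategory C] {X : DerCat E} (hX : leftLE E X) :
    (hi.derFunctor.obj X).IsLE 0 := by
  obtain ⟨L, hL, ⟨e⟩⟩ := hX
  have : ((i.mapHomologicalComplex (ComplexShape.up ℤ) ⋙ DerivedCategory.Q).obj L).IsLE 0 :=
    (DerivedCategory.isLE_Q_obj_iff _ 0).2 ((CochainComplex.isLE_iff _ 0).2 fun n hn =>
      (hi.strictlyExactAt_iff L n).1 (hL n hn))
  exact DerivedCategory.TStructure.t.isLE_of_iso
    ((hi.toDerCatCompDerFunctor.app L).symm ≪≫ hi.derFunctor.mapIso e) 0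

omit hi' in
theorem isGE_derFunctor_obj [HasDerivedCategory C] {X : DerCat E} (hX : leftGE E X) :
    (hi.derFunctor.obj X).IsGE 0 := by
  obtain ⟨L, hL, ⟨e⟩⟩ := hX
  have : ((i.mapHomologicalComplex (ComplexShape.up ℤ) ⋙ DerivedCategory.Q).obj L).IsGE 0 :=
    (DerivedCategory.isGE_Q_obj_iff _ 0).2 ((CochainComplex.isGE_iff _ 0).2 fun n hn =>
      (hi.strictlyExactAt_iff L n).1 (hL n hn))
  exact DerivedCategory.TStructure.t.isGE_of_iso
    ((hi.toDerCatCompDerFunctor.app L).symm ≪≫ hi.derFunctor.mapIso e) 0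

theorem exists_leftHeart_iso [HasDerivedCategory C] (A : C) :
    ∃ X : LeftHeart E, Nonempty (hi.derFunctor.obj X.obj ≅
      (DerivedCategory.singleFunctor C 0).obj A) := by
  obtain ⟨L, f, hf⟩ := hi.exists_quasiIso hi'
    ((HomologicalComplex.single C (ComplexShape.up ℤ) 0).obj A)
  have hL : ∀ n : ℤ, n ≠ 0 → StrictlyExactAt L n := fun n hn => by
    rw [hi.strictlyExactAt_iff]
    exact (exactAt_iff_of_quasiIsoAt f n).2
      (HomologicalComplex.exactAt_single_obj (ComplexShape.up ℤ) 0 A n hn)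
  have hQ : IsIso (DerivedCategory.Q.map f) := (DerivedCategory.isIso_Q_map_iff_quasiIso C f).2 hf
  let e : (i.mapHomologicalComplex (ComplexShape.up ℤ) ⋙ DerivedCategory.Q).obj L ≅
      (DerivedCategory.singleFunctor C 0).obj A :=
    @asIso _ _ _ _ (DerivedCategory.Q.map f) hQ
  exact ⟨⟨(toDerCat E).obj L, ⟨L, fun n hn => hL n hn.ne', ⟨Iso.refl _⟩⟩,
    ⟨L, fun n hn => hL n hn.ne, ⟨Iso.refl _⟩⟩⟩,
    ⟨hi.toDerCatCompDerFunctor.app L ≪≫ e⟩⟩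

/-- The fully faithful `derFunctor` sends the left heart to objects with cohomology only in degree
`0`, i.e. into the essential image of `C`. A resolution of an object of `C` is strictly exact off
degree `0`, which gives essential surjectivity. -/
theorem exists_leftHeart_equivalence :
    ∃ Φ : LeftHeart E ≌ C, Nonempty (toLeftHeart E ⋙ Φ.functor ≅ i) := by
  let := HasDerivedCategory.standard C
  have := hi.full_derFunctor hi'
  have := hi.faithful_derFunctor hi'
  let G : LeftHeart E ⥤ DerivedCategory C := (leftLE E ⊓ leftGE E).ι ⋙ hi.derFunctor
  have hG : ∀ X, (DerivedCategory.singleFunctor C 0).essImage (G.obj X) := fun X => by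
    have := hi.isLE_derFunctor_obj X.property.1
    have := hi.isGE_derFunctor_obj X.property.2
    obtain ⟨A, ⟨e⟩⟩ := DerivedCategory.exists_iso_singleFunctor_obj_of_isGE_of_isLE
      (hi.derFunctor.obj X.obj) 0
    exact ⟨A, ⟨e.symm⟩⟩
  let Ψ : LeftHeart E ⥤ C :=
    Functor.essImage.liftFunctor G (DerivedCategory.singleFunctor C 0) hG
  let iso : Ψ ⋙ DerivedCategory.singleFunctor C 0 ≅ G :=
    Functor.essImage.liftFunctorCompIso G (DerivedCategory.singleFunctor C 0) hG
  have : (Ψ ⋙ DerivedCategory.singleFunctor C 0).Full := Functor.Full.of_iso iso.symm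
  have : (Ψ ⋙ DerivedCategory.singleFunctor C 0).Faithful := Functor.Faithful.of_iso iso.symm
  have : Ψ.Faithful := Functor.Faithful.of_comp Ψ (DerivedCategory.singleFunctor C 0)
  have : Ψ.Full := Functor.Full.of_comp_faithful Ψ (DerivedCategory.singleFunctor C 0)
  have : Ψ.EssSurj := ⟨fun A => by
    obtain ⟨X, ⟨e⟩⟩ := hi.exists_leftHeart_iso hi' A
    exact ⟨X, ⟨(DerivedCategory.singleFunctor C 0).preimageIso (iso.app X ≪≫ e)⟩⟩⟩
  have : Ψ.IsEquivalence := { }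
  refine ⟨Ψ.asEquivalence, ⟨Functor.fullyFaithfulCancelRight (DerivedCategory.singleFunctor C 0) ?_⟩⟩
  exact Functor.associator _ _ _ ≪≫ Functor.isoWhiskerLeft _ iso ≪≫
    Functor.isoWhiskerLeft (HomologicalComplex.single E (ComplexShape.up ℤ) 0)
      hi.toDerCatCompDerFunctor ≪≫ (Functor.associator _ _ _).symm ≪≫
    Functor.isoWhiskerRight (HomologicalComplex.singleMapHomologicalComplex i _ 0) _ ≪≫
    Functor.associator _ _ _ ≪≫
    Functor.isoWhiskerLeft i (DerivedCategory.singleFunctorIsoCompQ C 0).symm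

end IsTorsionFreeEmbedding

end LeftHeartEquivalence

/-! ### The abelian category of quotients of representables -/

section Quotients

variable {E : Type u} [Category.{v} E] [Preadditive E]
  {A : Type w} [Category.{w'} A] [Abelian A]

/-- A functor to an abelian category which sends regular epimorphisms to epimorphisms, and such
that epimorphisms between subobjects of objects in its image and objects in its image are split
after a regular epimorphism. This holds for
the Yoneda embedding to the sheaves for the regular topology. -/
structure IsRegularEmbedding (y : E ⥤ A) : Prop where
  epi_map : ∀ {X Y : E} (g : X ⟶ Y), IsRegularEpi g → Epi (y.map g)
  exists_lift : ∀ {B : A} {X Z : E} (p : B ⟶ y.obj X) (m : B ⟶ y.obj Z), Epi p → Mono m →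
    ∃ (X' : E) (g : X' ⟶ X) (a : y.obj X' ⟶ B), IsRegularEpi g ∧ a ≫ p = y.map g

/-- The objects `B` with an epimorphism `y X ⟶ B` whose kernel is in the image of `y`. -/
def quotients (y : E ⥤ A) : ObjectProperty A := fun B =>
  ∃ (X : E) (p : y.obj X ⟶ B), Epi p ∧ y.essImage (kernel p)

/-- Two quotients with the same kernel are isomorphic. -/
theorem nonempty_iso_of_epi {X B B' : A} (p : X ⟶ B) (q : X ⟶ B') [Epi p] [Epi q]
    (h : ∀ {W : A} (k : W ⟶ X), k ≫ p = 0 ↔ k ≫ q = 0) : Nonempty (B ≅ B') := by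
  have hp := Abelian.epiIsCokernelOfKernel _ (kernelIsKernel p)
  have hq := Abelian.epiIsCokernelOfKernel _ (kernelIsKernel q)
  obtain ⟨a, ha⟩ := CokernelCofork.IsColimit.desc' hp q ((h _).1 (kernel.condition p))
  obtain ⟨b, hb⟩ := CokernelCofork.IsColimit.desc' hq p ((h _).2 (kernel.condition q))
  replace ha : p ≫ a = q := ha
  replace hb : q ≫ b = p := hb
  exact ⟨⟨a, b, by rw [← cancel_epi p, reassoc_of% ha, hb, Category.comp_id],
    by rw [← cancel_epi q, reassoc_of% hb, ha, Category.comp_id]⟩⟩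

variable (y : E ⥤ A)

instance : (quotients y).IsClosedUnderIsomorphisms where
  of_iso := by
    rintro B B' e ⟨X, p, hp, h⟩
    exact ⟨X, p ≫ e.hom, inferInstance, y.essImage.prop_of_iso (kernelCompMono p e.hom).symm h⟩

namespace IsRegularEmbedding

variable {y} [y.Full] [y.Additive] [HasZeroObject E] [HasBinaryBiproducts E]
  [PreservesFiniteLimits y] (hy : IsRegularEmbedding y)

omit [HasZeroObject E] [HasBinaryBiproducts E] in
theorem essImage_kernel [HasKernels E] {B B' : A} (hB : y.essImage B) (hB' : y.essImage B')
    (f : B ⟶ B') : y.essImage (kernel f) := by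
  obtain ⟨X, ⟨e⟩⟩ := hB
  obtain ⟨X', ⟨e'⟩⟩ := hB'
  obtain ⟨g, hg⟩ := y.map_surjective (e.hom ≫ f ≫ e'.inv)
  refine ⟨kernel g, ⟨PreservesKernel.iso y g ≪≫ kernel.mapIso _ _ e e' (by simp [hg])⟩⟩

include hy

omit [HasZeroObject E] [HasBinaryBiproducts E] in
-- `B` is the image in `A` of some `y.map g`. The epi `y.map (coimage.π g)` has the same kernel as
-- `p`, namely `y` of the kernel of `g`, so `B` is `y` of the coimage.
theorem essImage_of_mono_of_epi [HasKernels E] [HasCokernels E] {B : A} {X₀ X : E}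
    (p : y.obj X₀ ⟶ B) [Epi p] (m : B ⟶ y.obj X) [Mono m] : y.essImage B := by
  obtain ⟨g, hg⟩ := y.map_surjective (p ≫ m)
  have hw : kernel.ι g ≫ Abelian.coimage.π g = 0 := comp_coimage_π_eq_zero g _ (kernel.condition g)
  have := hy.epi_map (Abelian.coimage.π g) inferInstance
  obtain ⟨e⟩ := nonempty_iso_of_epi (y.map (Abelian.coimage.π g)) p (fun {W} k => by
    constructor
    · intro hk
      rw [← cancel_mono m, zero_comp, Category.assoc, ← hg, ← Abelian.coimage_image_factorisation g,
        y.map_comp, reassoc_of% hk, zero_comp]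
    · intro hk
      obtain ⟨l, hl⟩ := KernelFork.IsLimit.lift'
        (isLimitForkMapOfIsLimit' y (kernel.condition g) (kernelIsKernel g)) k
        (by rw [hg, reassoc_of% hk, zero_comp])
      replace hl : l ≫ y.map (kernel.ι g) = k := hl
      rw [← hl, Category.assoc, ← y.map_comp, hw, y.map_zero, comp_zero])
  exact ⟨_, ⟨e⟩⟩

/-- Because `Q` embeds in `y.obj Z`, the epi `q` splits after a strict epi `g : X'' ⟶ X`. The
extension is then the pushout in `A` of `y` of the kernel `j` of `g`, along `y.map s`. The same
pushout formed in `E` represents `Q`: its leg `a` is a strict mono by the pushout axiom, hence mono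
after `y`. -/
theorem essImage_of_extension [IsQuasiAbelian E] {Q : A} {X Z : E} (q : Q ⟶ y.obj X) [Epi q]
    (i : Q ⟶ y.obj Z) [Mono i] (hq : y.essImage (kernel q)) : y.essImage Q := by
  have : HasCoequalizers E := Preadditive.hasCoequalizers_of_hasCokernels
  have : HasPushouts E := hasPushouts_of_hasBinaryCoproducts_of_hasCoequalizers E
  obtain ⟨X₁, ⟨e⟩⟩ := hq
  obtain ⟨X'', g, α, hg, hα⟩ := hy.exists_lift q i inferInstance inferInstance
  obtain ⟨k, hk⟩ : ∃ k, k = e.hom ≫ kernel.ι q := ⟨_, rfl⟩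
  have hkm : Mono k := by rw [hk]; infer_instance
  have hkq : k ≫ q = 0 := by simp [hk]
  have lift : ∀ {W : A} (t : W ⟶ Q), t ≫ q = 0 → ∃ l, l ≫ k = t := fun t ht =>
    ⟨kernel.lift q t ht ≫ e.inv, by simp [hk]⟩
  let j := kernel.ι g
  have hj : j ≫ g = 0 := kernel.condition g
  have liftj : ∀ {W : A} (t : W ⟶ y.obj X''), t ≫ y.map g = 0 → ∃ r, r ≫ y.map j = t :=
    fun t ht => by
      obtain ⟨l, hl⟩ := KernelFork.IsLimit.lift'
        (isLimitForkMapOfIsLimit' y (kernel.condition g) (kernelIsKernel g)) t ht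
      exact ⟨l, hl⟩
  obtain ⟨s', hs'⟩ := lift (y.map j ≫ α) (by rw [Category.assoc, hα, ← y.map_comp, hj, y.map_zero])
  obtain ⟨s, rfl⟩ := y.map_surjective s'
  let a : X₁ ⟶ pushout s j := pushout.inl s j
  let b : X'' ⟶ pushout s j := pushout.inr s j
  have hab : s ≫ a = j ≫ b := pushout.condition
  have hab' : y.map s ≫ y.map a = y.map j ≫ y.map b := by rw [← y.map_comp, hab, y.map_comp]
  have ha : IsRegularMono a := isRegularMono_of_isPushout (IsPushout.of_hasPushout s j).flip
  have ham : Mono a := (IsRegularMono.getStruct a).mono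
  have hyam : Mono (y.map a) := inferInstance
  -- `ρ` presents the pushout as the cokernel of `(s, j)`, so `y.map ρ` is epi; `m` below plays the
  -- same role for `Q`.
  let ρ : X₁ ⊞ X'' ⟶ pushout s j := biprod.desc a (-b)
  have hρ : IsRegularEpi ρ := by
    have : Epi ρ := Preadditive.epi_of_cancel_zero _ (fun h hh => by
      have h1 : a ≫ h = 0 := by rw [← biprod.inl_desc a (-b), Category.assoc, hh, comp_zero]
      have h2 : b ≫ h = 0 := by
        rw [← neg_inj, ← Preadditive.neg_comp, ← biprod.inr_desc a (-b), Category.assoc, hh,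
          comp_zero, neg_zero]
      exact pushout.hom_ext (by rw [h1, comp_zero]) (by rw [h2, comp_zero]))
    refine isRegularEpi_of_desc (biprod.lift s j) ρ (by simp [ρ, hab]) (fun {Z} h hh => ?_)
    refine ⟨pushout.desc (biprod.inl ≫ h) (-(biprod.inr ≫ h)) ?_, ?_⟩
    · rw [biprod.lift_eq] at hh
      rw [Preadditive.comp_neg, eq_neg_iff_add_eq_zero]
      simpa using hh
    · apply biprod.hom_ext'
      · rw [biprod.inl_desc_assoc]
        exact pushout.inl_desc _ _ _
      · rw [biprod.inr_desc_assoc, Preadditive.neg_comp, neg_eq_iff_eq_neg]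
        exact pushout.inr_desc _ _ _
  have := hy.epi_map ρ hρ
  let m : y.obj (X₁ ⊞ X'') ⟶ Q := y.map biprod.fst ≫ k - y.map biprod.snd ≫ α
  have hm₁ : y.map biprod.inl ≫ m = k := by
    simp only [m, Preadditive.comp_sub, ← Functor.map_comp_assoc]
    simp
  have hm₂ : y.map biprod.inr ≫ m = -α := by
    simp only [m, Preadditive.comp_sub, ← Functor.map_comp_assoc]
    simp
  have hρ' : y.map ρ = y.map biprod.fst ≫ y.map a - y.map biprod.snd ≫ y.map b := by
    simp only [ρ, biprod.desc_eq, Preadditive.comp_neg, y.map_add, y.map_neg, y.map_comp,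
      sub_eq_add_neg]
  have : Epi m := Preadditive.epi_of_cancel_zero _ (fun {Z} h hh => by
    have h1 : k ≫ h = 0 := by rw [← hm₁, Category.assoc, hh, comp_zero]
    have h2 : α ≫ h = 0 := by
      rw [← neg_inj, ← Preadditive.neg_comp, ← hm₂, Category.assoc, hh, comp_zero, neg_zero]
    obtain ⟨l, hl⟩ := CokernelCofork.IsColimit.desc' (Abelian.epiIsCokernelOfKernel _
      (kernelIsKernel q)) h (by
        change kernel.ι q ≫ h = 0
        rw [← cancel_epi e.hom, comp_zero, ← Category.assoc, ← hk, h1])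
    replace hl : q ≫ l = h := hl
    have := hy.epi_map g hg
    have : l = 0 := by rw [← cancel_epi (y.map g), ← hα, Category.assoc, hl, h2, comp_zero]
    rw [← hl, this, comp_zero])
  -- For both maps, the pairs `(t₁, t₂)` sent to zero are those of the form `(r ≫ y.map s, r ≫ y.map
  -- j)`: mapping to `X` forces `t₂` through `j`, and monicity of `y.map a`, respectively `k`, then
  -- determines `t₁`.
  obtain ⟨e'⟩ := nonempty_iso_of_epi (y.map ρ) m (fun {W} t => by
    obtain ⟨c, hc₁, hc₂⟩ : ∃ c : pushout s j ⟶ X, a ≫ c = 0 ∧ b ≫ c = g :=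
      ⟨pushout.desc 0 g (by rw [comp_zero, hj]), pushout.inl_desc _ _ _, pushout.inr_desc _ _ _⟩
    obtain ⟨t₁, ht₁⟩ : ∃ t₁, t₁ = t ≫ y.map biprod.fst := ⟨_, rfl⟩
    obtain ⟨t₂, ht₂⟩ : ∃ t₂, t₂ = t ≫ y.map biprod.snd := ⟨_, rfl⟩
    have e₁ : t ≫ y.map ρ = t₁ ≫ y.map a - t₂ ≫ y.map b := by
      rw [hρ', Preadditive.comp_sub, ht₁, ht₂, Category.assoc, Category.assoc]
    have e₂ : t ≫ m = t₁ ≫ k - t₂ ≫ α := by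
      rw [ht₁, ht₂, Category.assoc, Category.assoc, ← Preadditive.comp_sub]
    rw [e₁, e₂, sub_eq_zero, sub_eq_zero]
    constructor
    · intro h
      obtain ⟨r, hr⟩ := liftj t₂ (by
        rw [← hc₂, y.map_comp, ← reassoc_of% h, ← y.map_comp, hc₁, y.map_zero, comp_zero])
      have : t₁ = r ≫ y.map s := by
        rw [← cancel_mono (y.map a), h, Category.assoc, hab', ← hr, Category.assoc]
      rw [this, ← hr, Category.assoc, Category.assoc, hs']
    · intro h
      obtain ⟨r, hr⟩ := liftj t₂ (by rw [← hα, ← reassoc_of% h, hkq, comp_zero])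
      have : t₁ = r ≫ y.map s := by
        rw [← cancel_mono k, h, Category.assoc, hs', ← hr, Category.assoc]
      rw [this, ← hr, Category.assoc, Category.assoc, hab'])
  exact ⟨_, ⟨e'⟩⟩

variable [IsQuasiAbelian E]

/-- The pullback is an extension of `y.obj X` by `kernel p`, and it embeds in `y.obj (X ⊞ X₀)`. -/
theorem essImage_pullback {X₀ X : E} {B : A} (h : y.obj X ⟶ B) (p : y.obj X₀ ⟶ B) [Epi p]
    (hp : y.essImage (kernel p)) : y.essImage (pullback h p) := by
  have sq := IsPullback.of_hasPullback h p
  have := isIso_kernel_map_of_isPullback sq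
  have := preservesBinaryBiproducts_of_preservesBiproducts y
  have : Mono (biprod.lift (pullback.fst h p) (pullback.snd h p)) := ⟨fun f g hfg =>
    pullback.hom_ext (by simpa using hfg =≫ biprod.fst) (by simpa using hfg =≫ biprod.snd)⟩
  exact hy.essImage_of_extension (pullback.fst h p)
    (biprod.lift (pullback.fst h p) (pullback.snd h p) ≫ (y.mapBiprod X X₀).inv)
    (y.essImage.prop_of_iso (asIso (kernel.map (pullback.fst h p) p _ _ sq.w)).symm hp)

/-- `kernel h` is also the kernel of the projection `pullback h p ⟶ y.obj X₀`, a morphism between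
objects in the image of `y`. -/
theorem essImage_kernel_of_quotients {X : E} {B : A} (hB : quotients y B) (h : y.obj X ⟶ B) :
    y.essImage (kernel h) := by
  obtain ⟨X₀, p, _, hp⟩ := hB
  have sq := (IsPullback.of_hasPullback h p).flip
  have := isIso_kernel_map_of_isPullback sq
  exact y.essImage.prop_of_iso (asIso (kernel.map (pullback.snd h p) h _ _ sq.w))
    (essImage_kernel (hy.essImage_pullback h p hp) (y.obj_mem_essImage X₀) _)

/-- The kernel of `f` is covered by `kernel (p ≫ f)`, and the kernel of this cover is that of a
morphism `y.obj Z ⟶ B`; both lie in the image of `y`. -/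
theorem isClosedUnderKernels : (quotients y).IsClosedUnderKernels where
  kernels_le := by
    rintro _ ⟨f, k, hk, hB, hD⟩
    rename_i B D
    have hkm : Mono k.ι := mono_of_isLimit_fork hk
    obtain ⟨X, p, _, hp⟩ := id hB
    obtain ⟨Z, ⟨e⟩⟩ := hy.essImage_kernel_of_quotients hD (p ≫ f)
    obtain ⟨q, hq⟩ := KernelFork.IsLimit.lift' hk (e.hom ≫ kernel.ι (p ≫ f) ≫ p) (by simp)
    refine ⟨Z, q, ?_, ?_⟩
    · rw [epi_iff_surjective_up_to_refinements]
      intro W t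
      obtain ⟨W', π, _, x, hx⟩ := surjective_up_to_refinements_of_epi p (t ≫ k.ι)
      refine ⟨W', π, inferInstance, kernel.lift (p ≫ f) x (by
        rw [← reassoc_of% hx, k.condition, comp_zero, comp_zero]) ≫ e.inv, ?_⟩
      rw [← cancel_mono k.ι, Category.assoc, Category.assoc, hq, Category.assoc,
        e.inv_hom_id_assoc, kernel.lift_ι_assoc, hx]
    · exact y.essImage.prop_of_iso (kernelCompMono q k.ι)
        (hy.essImage_kernel_of_quotients hB (q ≫ k.ι))

/-- The kernel of `q ≫ c.π` is covered by the pullback of `p ≫ f` and `q`, and is a subobject of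
`y.obj Y`; so `essImage_of_mono_of_epi` applies. -/
theorem isClosedUnderCokernels : (quotients y).IsClosedUnderCokernels where
  cokernels_le := by
    rintro _ ⟨f, c, hc, hB, hD⟩
    rename_i B D
    have hce : Epi c.π := epi_of_isColimit_cofork hc
    obtain ⟨X, p, _, -⟩ := hB
    obtain ⟨Y, q, _, hq⟩ := hD
    refine ⟨Y, q ≫ c.π, inferInstance, ?_⟩
    obtain ⟨Z, ⟨e⟩⟩ := hy.essImage_pullback (p ≫ f) q hq
    have hex : (ShortComplex.mk f c.π c.condition).Exact :=
      ShortComplex.exact_of_g_is_cokernel _ (IsColimit.ofIsoColimit hc (Cofork.ext (Iso.refl _)))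
    let r : y.obj Z ⟶ kernel (q ≫ c.π) := kernel.lift _ (e.hom ≫ pullback.snd (p ≫ f) q) (by
      rw [Category.assoc, ← pullback.condition_assoc, Category.assoc, c.condition, comp_zero,
        comp_zero, comp_zero])
    have : Epi r := by
      rw [epi_iff_surjective_up_to_refinements]
      intro W t
      obtain ⟨W₁, π₁, _, x₁, hx₁⟩ := hex.exact_up_to_refinements (t ≫ kernel.ι _ ≫ q) (by simp)
      obtain ⟨W₂, π₂, _, x₂, hx₂⟩ := surjective_up_to_refinements_of_epi p x₁
      refine ⟨W₂, π₂ ≫ π₁, inferInstance,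
        pullback.lift x₂ (π₂ ≫ π₁ ≫ t ≫ kernel.ι _) ?_ ≫ e.inv, ?_⟩
      · dsimp at hx₁
        simp only [Category.assoc]
        rw [hx₁, reassoc_of% hx₂]
      · rw [← cancel_mono (kernel.ι (q ≫ c.π))]
        simpa [r] using (pullback.lift_snd _ _ _).symm
    exact hy.essImage_of_mono_of_epi r (kernel.ι (q ≫ c.π))

omit [y.Full] [HasZeroObject E] [PreservesFiniteLimits y] [IsQuasiAbelian E] hy in
theorem quotients_biprod {B B' : A} (hB : quotients y B) (hB' : quotients y B') :
    quotients y (B ⊞ B') := by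
  have := preservesBinaryBiproducts_of_preservesBiproducts y
  obtain ⟨X, p, _, K, ⟨e⟩⟩ := hB
  obtain ⟨X', p', _, K', ⟨e'⟩⟩ := hB'
  refine ⟨X ⊞ X', (y.mapBiprod X X').hom ≫ biprod.map p p', inferInstance, K ⊞ K', ⟨?_⟩⟩
  let k : kernel p ⊞ kernel p' ⟶ y.obj X ⊞ y.obj X' := biprod.map (kernel.ι p) (kernel.ι p')
  have w : k ≫ biprod.map p p' = 0 := by
    apply biprod.hom_ext' <;> simp [k]
  have hk : IsLimit (KernelFork.ofι k w) := KernelFork.IsLimit.ofι' _ _ (fun {W} t ht =>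
    ⟨biprod.lift (kernel.lift p (t ≫ biprod.fst) (by
        simpa using ht =≫ biprod.fst)) (kernel.lift p' (t ≫ biprod.snd) (by
        simpa using ht =≫ biprod.snd)), by apply biprod.hom_ext <;> simp [k]⟩)
  exact y.mapBiprod K K' ≪≫ biprod.mapIso e e' ≪≫
    hk.conePointUniqueUpToIso (kernelIsKernel (biprod.map p p')) ≪≫
    (kernelIsIsoComp (y.mapBiprod X X').hom (biprod.map p p')).symm

open ZeroObject in
omit [IsQuasiAbelian E] [HasBinaryBiproducts E] hy in
theorem containsZero [HasKernels E] : (quotients y).ContainsZero where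
  exists_zero := by
    have h0 : IsZero (y.obj 0) := y.map_isZero (isZero_zero E)
    exact ⟨y.obj 0, h0, 0, 𝟙 _, inferInstance,
      essImage_kernel (y.obj_mem_essImage _) (y.obj_mem_essImage _) _⟩

omit [IsQuasiAbelian E] hy in
theorem isClosedUnderFiniteProducts [HasKernels E] : (quotients y).IsClosedUnderFiniteProducts := by
  have := containsZero (y := y)
  have : (quotients y).IsClosedUnderBinaryProducts := ⟨by
    rintro B ⟨p, hp⟩
    have := p.isLimit
    have e : B ≅ p.diag.obj ⟨.left⟩ ⊞ p.diag.obj ⟨.right⟩ :=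
      p.isLimit.conePointUniqueUpToIso ((IsLimit.postcomposeHomEquiv (diagramIsoPair p.diag).symm _).symm (BinaryBiproduct.isLimit _ _))
    exact (quotients y).prop_of_iso e.symm (quotients_biprod (hp _) (hp _))⟩
  exact ObjectProperty.IsClosedUnderFiniteProducts.mk'

end IsRegularEmbedding

end Quotients

/-! ### The abelian category of quotients and its cotilting torsion pair. -/

section

variable {E : Type u} [Category.{v} E] [Preadditive E] [HasZeroObject E] [HasBinaryBiproducts E]

/-- A fully faithful left exact functor to an abelian category, sending regular epimorphisms to
epimorphisms, and such that every object has a resolution of length one by objects in the image,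
identifies a quasi-abelian category with the torsion-free part of a cotilting torsion pair. -/
theorem exists_cotilting_of_resolutions [IsQuasiAbelian E] {C : Type w} [Category.{w'} C]
    [Abelian C] (j : E ⥤ C) [j.Full] [j.Faithful] [j.Additive] [PreservesFiniteLimits j]
    (hj : ∀ {X Y : E} (g : X ⟶ Y), IsRegularEpi g → Epi (j.map g))
    (hj' : ∀ B : C, quotients j B) :
    ∃ t : TorsionPair C, t.IsCotilting ∧ Nonempty (E ≌ t.free.FullSubcategory) := by
  have : HasCoequalizers E := Preadditive.hasCoequalizers_of_hasCokernels
  have : HasPushouts E := hasPushouts_of_hasBinaryCoproducts_of_hasCoequalizers E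
  refine ⟨{ torsion := fun T => ∀ (Z : E) (φ : T ⟶ j.obj Z), φ = 0
            free := j.essImage
            torsion_isClosedUnderIsomorphisms := ⟨fun e h Z φ => by
              rw [← cancel_epi e.hom, comp_zero]; exact h Z _⟩
            hom_eq_zero := ?_
            exists_shortExact := ?_ }, ?_, ⟨j.toEssImage.asEquivalence⟩⟩
  · rintro T F hT ⟨Z, ⟨e⟩⟩ f
    rw [← cancel_mono e.inv, zero_comp]
    exact hT Z _
  · intro B
    obtain ⟨X₀, p, _, X₁, ⟨e⟩⟩ := hj' B
    -- With `B` the cokernel of `j.map f`, the torsion-free quotient of `B` is the cokernel of `f`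
    -- taken in `E`.
    obtain ⟨f, hf⟩ := j.map_surjective (e.hom ≫ kernel.ι p)
    obtain ⟨Y, c, hc, hfc, desc⟩ : ∃ (Y : E) (c : X₀ ⟶ Y), IsRegularEpi c ∧ f ≫ c = 0 ∧
        ∀ {W : E} (h : X₀ ⟶ W), f ≫ h = 0 → ∃ d, c ≫ d = h :=
      ⟨_, cokernel.π f, inferInstance, cokernel.condition f,
        fun h hh => ⟨cokernel.desc f h hh, cokernel.π_desc _ _ _⟩⟩
    have : Epi (j.map c) := hj c hc
    have hfp : j.map f ≫ p = 0 := by rw [hf, Category.assoc, kernel.condition, comp_zero]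
    obtain ⟨r, hr⟩ : ∃ r : B ⟶ j.obj Y, p ≫ r = j.map c := by
      obtain ⟨r, hr⟩ := CokernelCofork.IsColimit.desc' (Abelian.epiIsCokernelOfKernel _
      (kernelIsKernel p)) (j.map c) (by
        change kernel.ι p ≫ j.map c = 0
        rw [← cancel_epi e.hom, comp_zero, ← Category.assoc, ← hf, ← j.map_comp, hfc, j.map_zero])
      exact ⟨r, hr⟩
    have : Epi r := epi_of_epi_fac hr
    refine ⟨kernel r, j.obj Y, kernel.ι r, r, kernel.condition r, ?_,
      j.obj_mem_essImage _, ⟨ShortComplex.exact_kernel r⟩⟩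
    intro Z φ
    -- The kernel of `r` is covered by `j.obj K` through `s`, so `φ` is controlled by a morphism `ψ
    -- : K ⟶ Z` vanishing on `X₁`.
    let K := kernel c
    let k := kernel.ι c
    let l : X₁ ⟶ K := kernel.lift c f hfc
    have hl : l ≫ k = f := kernel.lift_ι _ _ _
    let s : j.obj K ⟶ kernel r := kernel.lift r (j.map k ≫ p) (by
      rw [Category.assoc, hr, ← j.map_comp, kernel.condition, j.map_zero])
    have hs : s ≫ kernel.ι r = j.map k ≫ p := kernel.lift_ι _ _ _
    have : Epi s := by
      rw [epi_iff_surjective_up_to_refinements]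
      intro W t
      obtain ⟨W', π, _, x, hx⟩ := surjective_up_to_refinements_of_epi p (t ≫ kernel.ι r)
      obtain ⟨x', hx'⟩ := KernelFork.IsLimit.lift'
        (isLimitForkMapOfIsLimit' j (kernel.condition c) (kernelIsKernel c)) x (by
          rw [← hr, ← reassoc_of% hx, kernel.condition r, comp_zero, comp_zero])
      replace hx' : x' ≫ j.map k = x := hx'
      refine ⟨W', π, inferInstance, x', ?_⟩
      rw [← cancel_mono (kernel.ι r), Category.assoc, Category.assoc, hs, reassoc_of% hx', hx]
    obtain ⟨ψ, hψ⟩ := j.map_surjective (s ≫ φ)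
    have hlψ : l ≫ ψ = 0 := j.map_injective (by
      have : j.map l ≫ s = 0 := by
        rw [← cancel_mono (kernel.ι r), Category.assoc, hs, ← j.map_comp_assoc, hl, hfp, zero_comp]
      rw [j.map_comp, hψ, reassoc_of% this, zero_comp, j.map_zero])
    -- the pushout of `k` along `ψ` is a monomorphism, and it kills `ψ`
    have hm : IsRegularMono (pushout.inr k ψ) :=
      isRegularMono_of_isPushout (IsPushout.of_hasPushout k ψ)
    have : Mono (pushout.inr k ψ) := (IsRegularMono.getStruct _).mono
    obtain ⟨d, hd⟩ : ∃ d, c ≫ d = pushout.inl k ψ :=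
      desc _ (by rw [← hl, Category.assoc, pushout.condition, reassoc_of% hlψ, zero_comp])
    have : ψ = 0 := by
      rw [← cancel_mono (pushout.inr k ψ), ← pushout.condition, ← hd, kernel.condition_assoc,
        zero_comp, zero_comp]
    rw [← cancel_epi s, ← hψ, this, j.map_zero, comp_zero]
  · intro B
    obtain ⟨X, p, _, -⟩ := hj' B
    exact ⟨_, p, j.obj_mem_essImage X, inferInstance⟩

omit [Preadditive E] [HasZeroObject E] [HasBinaryBiproducts E] in
/-- The property `quotients` is reflected by fully faithful functors preserving kernels. -/
theorem quotients_of_iso {C : Type*} [Category* C] [Abelian C] {A : Type w} [Category.{w'} A]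
    [Abelian A] {y : E ⥤ A} {j : E ⥤ C} (F : C ⥤ A) [F.Full] [F.Faithful] [F.Additive]
    [∀ {X Y : C} (f : X ⟶ Y), PreservesLimit (parallelPair f 0) F]
    (i : j ⋙ F ≅ y) {B : C} (hB : quotients y (F.obj B)) : quotients j B := by
  obtain ⟨X, p, _, Z, ⟨e⟩⟩ := hB
  obtain ⟨q, hq⟩ := F.map_surjective (i.hom.app X ≫ p)
  have : Epi (F.map q) := by rw [hq]; infer_instance
  refine ⟨X, q, F.epi_of_epi_map this, Z, ⟨F.preimageIso (i.app Z ≪≫ e ≪≫ ?_)⟩⟩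
  exact (kernelIsIsoComp (i.hom.app X) p).symm ≪≫ kernelIsoOfEq hq.symm ≪≫
    (PreservesKernel.iso F q).symm

/-- The closure properties make `quotients y` an abelian subcategory with kernels computed in `A`.
Its objects are cokernels of `y.map f` for arrows `f` of `E`, so a small model exists in the
required universe. -/
theorem IsRegularEmbedding.exists_cotilting [IsQuasiAbelian E] {A : Type w} [Category.{w'} A]
    [Abelian A] [LocallySmall.{max u v} A] {y : E ⥤ A} [y.Full] [y.Faithful] [y.Additive]
    [PreservesFiniteLimits y] (hy : IsRegularEmbedding y) :
    ∃ (C : Type (max u v)) (_ : Category.{max u v} C) (_ : Abelian C) (t : TorsionPair C),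
      t.IsCotilting ∧ Nonempty (E ≌ t.free.FullSubcategory) := by
  let P := quotients y
  have := hy.isClosedUnderKernels
  have := hy.isClosedUnderCokernels
  have : P.IsClosedUnderFiniteProducts := isClosedUnderFiniteProducts
  have : P.ContainsZero := containsZero
  have : ObjectProperty.EssentiallySmall.{max u v} P := by
    let ι := Σ (X₁ X₀ : E), (X₁ ⟶ X₀)
    refine ⟨ObjectProperty.ofObj (fun i : ι => cokernel (y.map i.2.2)), inferInstance, ?_⟩
    rintro B ⟨X₀, p, _, X₁, ⟨e⟩⟩
    obtain ⟨f, hf⟩ := y.map_surjective (e.hom ≫ kernel.ι p)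
    refine ⟨_, ⟨(⟨X₁, X₀, f⟩ : ι)⟩, nonempty_iso_of_epi p (cokernel.π (y.map f)) ?_⟩
    intro W k
    have hp : y.map f ≫ p = 0 := by rw [hf, Category.assoc, kernel.condition, comp_zero]
    constructor
    · intro h
      have : k = kernel.lift p k h ≫ e.inv ≫ y.map f := by simp [hf]
      rw [this, Category.assoc, Category.assoc, cokernel.condition, comp_zero, comp_zero]
    · intro h
      rw [← cokernel.π_desc (y.map f) p hp, reassoc_of% h, zero_comp]
  let S := SmallModel.{max u v} P.FullSubcategory
  let ε : P.FullSubcategory ≌ S := equivSmallModel _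
  let _ : Preadditive S := .ofFullyFaithful ε.fullyFaithfulInverse
  have : ε.inverse.Additive := ε.fullyFaithfulInverse.additive_ofFullyFaithful
  have : HasFiniteProducts S := ⟨fun n => Adjunction.hasLimitsOfShape_of_equivalence ε.inverse⟩
  let _ : Abelian S := abelianOfEquivalence ε.inverse
  let F : S ⥤ A := ε.inverse ⋙ P.ι
  let j : E ⥤ S := P.lift y (fun X => ⟨X, 𝟙 _, inferInstance,
    essImage_kernel (y.obj_mem_essImage _) (y.obj_mem_essImage _) _⟩) ⋙ ε.functor
  let i : j ⋙ F ≅ y := Functor.isoWhiskerRight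
    (Functor.associator _ _ _ ≪≫ Functor.isoWhiskerLeft _ ε.unitIso.symm) P.ι
  have : (j ⋙ F).Full := Functor.Full.of_iso i.symm
  have : j.Full := Functor.Full.of_comp_faithful j F
  have : j.Faithful := Functor.Faithful.of_comp_iso i
  have : PreservesFiniteLimits (j ⋙ F) := preservesFiniteLimits_of_natIso i.symm
  have : PreservesFiniteLimits j := preservesFiniteLimits_of_reflects_of_preserves j F
  have : (j ⋙ F).Additive := Functor.additive_of_iso i.symm
  have : j.Additive := Functor.additive_of_comp_faithful j F
  have {X Y : S} (f : X ⟶ Y) : PreservesLimit (parallelPair f 0) F := by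
    have := P.preservesKernels_ι (ε.inverse.map f)
    have : PreservesLimit (parallelPair f 0 ⋙ ε.inverse) P.ι :=
      preservesLimit_of_iso_diagram P.ι (K₁ := parallelPair (ε.inverse.map f) 0)
        (parallelPair.ext (Iso.refl _) (Iso.refl _) (by simp) (by simp))
    exact inferInstanceAs (PreservesLimit _ (ε.inverse ⋙ P.ι))
  refine ⟨S, inferInstance, inferInstance, exists_cotilting_of_resolutions j ?_ ?_⟩
  · intro X Y g hg
    have := hy.epi_map g hg
    have : Epi (F.map (j.map g)) := by
      change Epi ((j ⋙ F).map g)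
      rw [← NatIso.naturality_2 i g]; infer_instance
    exact F.epi_of_epi_map this
  · exact fun B => quotients_of_iso F i (ε.inverse.obj B).property

end

/-! ### Sheaves for the regular topology. -/

section Sheaves

open Opposite

variable (E : Type w) [SmallCategory E] [Preadditive E] [HasZeroObject E] [HasBinaryBiproducts E]
  [IsQuasiAbelian E]

theorem IsQuasiAbelian.hasFiniteLimits : HasFiniteLimits E := by
  have : HasKernels E := IsQuasiAbelian.hasKernels
  have : HasEqualizers E := Preadditive.hasEqualizers_of_hasKernels
  have := hasFiniteProducts_of_has_binary_and_terminal (C := E)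
  exact hasFiniteLimits_of_hasEqualizers_and_finite_products

theorem isRegularEpi_iff_effectiveEpi {X Y : E} (f : X ⟶ Y) : IsRegularEpi f ↔ EffectiveEpi f := by
  have := IsQuasiAbelian.hasFiniteLimits E
  exact CategoryTheory.isRegularEpi_iff_effectiveEpi f

instance : Preregular E where
  exists_fac {X Y Z} f g _ := by
    have := IsQuasiAbelian.hasFiniteLimits E
    have : IsRegularEpi g := (isRegularEpi_iff_effectiveEpi E g).2 inferInstance
    exact ⟨pullback f g, pullback.fst f g, (isRegularEpi_iff_effectiveEpi E _).1
      (isRegularEpi_of_isPullback (IsPullback.of_hasPullback f g)), pullback.snd f g,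
      pullback.condition.symm⟩

theorem isSheaf_preadditiveYoneda (X : E) :
    Presheaf.IsSheaf (regularTopology E) (preadditiveYoneda.obj X) := by
  rw [Presheaf.isSheaf_iff_isSheaf_forget _ _ (forget AddCommGrpCat.{w}),
    isSheaf_iff_isSheaf_of_type]
  exact regularTopology.isSheaf_yoneda_obj X

/-- The Yoneda embedding to the category of sheaves for the regular topology. -/
def sheafYoneda : E ⥤ Sheaf (regularTopology E) AddCommGrpCat.{w} :=
  ObjectProperty.lift _ preadditiveYoneda (isSheaf_preadditiveYoneda E)

instance : (sheafYoneda E).Full := inferInstanceAs (ObjectProperty.lift _ _ _).Full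
instance : (sheafYoneda E).Faithful := inferInstanceAs (ObjectProperty.lift _ _ _).Faithful
instance : (preadditiveYoneda : E ⥤ _).Additive where
  map_add {X Y f g} := by
    ext Z h
    exact Preadditive.comp_add _ _ _ _ _ _
instance : (sheafYoneda E).Additive where
  map_add := ObjectProperty.hom_ext _ (preadditiveYoneda.map_add)

instance : PreservesFiniteLimits (preadditiveYoneda : E ⥤ Eᵒᵖ ⥤ AddCommGrpCat.{w}) where
  preservesFiniteLimits J _ _ := by
    refine preservesLimitsOfShape_of_evaluation _ _ (fun X => ?_)
    exact inferInstanceAs (PreservesLimitsOfShape J (preadditiveCoyoneda.obj X))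

instance : PreservesFiniteLimits (sheafYoneda E) := by
  have : PreservesFiniteLimits (sheafYoneda E ⋙ sheafToPresheaf _ _) :=
    inferInstanceAs (PreservesFiniteLimits preadditiveYoneda)
  exact preservesFiniteLimits_of_reflects_of_preserves _ (sheafToPresheaf _ _)

/-- Epis of sheaves are the locally surjective maps, and a cover contains a single strict epi.
Lifting the section `𝟙 X` locally along `p` gives `g : X' ⟶ X` and a section `b` of `B` over `X'`,
which defines `a` by Yoneda. -/
theorem isRegularEmbedding_sheafYoneda : IsRegularEmbedding (sheafYoneda E) where
  epi_map {X Y} g hg := by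
    rw [← Sheaf.isLocallySurjective_iff_epi']
    refine ⟨fun {U} s => ?_⟩
    have := IsQuasiAbelian.hasFiniteLimits E
    let s' : U ⟶ Y := s
    refine regularTopology.mem_sieves_of_hasEffectiveEpi _ ⟨pullback s' g, pullback.fst s' g,
      (isRegularEpi_iff_effectiveEpi E _).1
        (isRegularEpi_of_isPullback (IsPullback.of_hasPullback s' g)), ?_⟩
    exact ⟨pullback.snd s' g, pullback.condition.symm⟩
  exists_lift {B X Z} p m _ _ := by
    have : Sheaf.IsLocallySurjective p := (Sheaf.isLocallySurjective_iff_epi' _ p).2 inferInstance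
    have h := Presheaf.imageSieve_mem (regularTopology E) p.hom (U := op X) (𝟙 X : X ⟶ X)
    rw [regularTopology.mem_sieves_iff_hasEffectiveEpi] at h
    obtain ⟨X', g, hg, b, hb⟩ := h
    have hm : ∀ U, Function.Injective (m.hom.app U) := by
      have : Mono ((sheafToPresheaf _ _).map m) := inferInstance
      intro U
      have := (NatTrans.mono_iff_mono_app m.hom).1 this U
      exact (AddCommGrpCat.mono_iff_injective _).1 this
    let u : X' ⟶ Z := m.hom.app _ b
    have hu : ∀ {V : E} (φ : V ⟶ X'), m.hom.app (op V) (B.obj.map φ.op b) = (φ ≫ u : V ⟶ Z) :=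
      fun φ => NatTrans.naturality_apply m.hom φ.op b
    -- A sheaf here need not be an additive functor; additivity is checked in `y.obj Z`, using that
    -- `m` is mono.
    have hadd : ∀ {V : E} (φ ψ : V ⟶ X'),
        B.obj.map (φ + ψ).op b = B.obj.map φ.op b + B.obj.map ψ.op b := fun φ ψ => by
      apply hm
      rw [map_add, hu, hu, hu]
      exact Preadditive.add_comp _ _ _ _ _ _
    have hcomp : ∀ {V W : E} (f : W ⟶ V) (φ : V ⟶ X'),
        B.obj.map (f ≫ φ).op b = B.obj.map f.op (B.obj.map φ.op b) := fun f φ => by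
      rw [op_comp, B.obj.map_comp, ConcreteCategory.comp_apply]
    have hp : ∀ {V : E} (φ : V ⟶ X'), p.hom.app (op V) (B.obj.map φ.op b) = (φ ≫ g : V ⟶ X) :=
      fun φ => (NatTrans.naturality_apply p.hom φ.op b).trans
        ((congrArg (((sheafYoneda E).obj X).obj.map φ.op) hb).trans
          (congrArg (fun k : X' ⟶ X => φ ≫ k) (Category.comp_id g)))
    refine ⟨X', g, ObjectProperty.homMk
      { app U := AddCommGrpCat.ofHom
          (AddMonoidHom.mk' (fun φ : U.unop ⟶ X' => B.obj.map φ.op b) (fun φ ψ => hadd φ ψ))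
        naturality := fun U V f => AddCommGrpCat.hom_ext
          (AddMonoidHom.ext (fun φ => hcomp f.unop φ)) },
      (isRegularEpi_iff_effectiveEpi E g).2 hg, ?_⟩
    refine ObjectProperty.hom_ext _ ?_
    ext U φ
    exact hp φ

end Sheaves

/-- A quasi-abelian category is the torsion-free part of a cotilting torsion pair. -/
theorem IsQuasiAbelian.exists_cotilting (E : Type u) [Category.{v} E] [Preadditive E]
    [HasZeroObject E] [HasBinaryBiproducts E] [IsQuasiAbelian E] :
    ∃ (C : Type (max u v)) (_ : Category.{max u v} C) (_ : Abelian C) (t : TorsionPair C),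
      t.IsCotilting ∧ Nonempty (E ≌ t.free.FullSubcategory) := by
  -- The sheaf construction above is for small categories.
  let ε : E ≌ AsSmall.{max u v} E := AsSmall.equiv
  have : ε.functor.Additive := inferInstanceAs AsSmall.up.Additive
  have : HasZeroObject (AsSmall.{max u v} E) := ε.functor.hasZeroObject_of_additive
  have : HasBinaryBiproducts (AsSmall.{max u v} E) :=
    have := hasFiniteProducts_of_has_binary_and_terminal (C := E)
    have := ε.functor.hasFiniteProducts_of_additive_of_essSurj
    .of_hasBinaryProducts
  have : IsQuasiAbelian (AsSmall.{max u v} E) := IsQuasiAbelian.of_equivalence ε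
  obtain ⟨C, _, _, t, ht, ⟨e⟩⟩ :=
    (isRegularEmbedding_sheafYoneda (AsSmall.{max u v} E)).exists_cotilting
  exact ⟨C, inferInstance, inferInstance, t, ht, ⟨ε.trans e⟩⟩

/-! ### Duality and orthogonality for torsion pairs. -/

namespace TorsionPair

section

variable {C : Type w} [Category.{w'} C] [Abelian C] (t : TorsionPair C)

/-- The opposite torsion pair. -/
def op : TorsionPair Cᵒᵖ where
  torsion := t.free.op
  free := t.torsion.op
  torsion_isClosedUnderIsomorphisms :=
    have := t.free_isClosedUnderIsomorphisms
    inferInstance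
  free_isClosedUnderIsomorphisms :=
    have := t.torsion_isClosedUnderIsomorphisms
    inferInstance
  hom_eq_zero hT hF f := Quiver.Hom.unop_inj (t.hom_eq_zero hF hT f.unop)
  exists_shortExact X := by
    obtain ⟨T, F, i, p, zero, hT, hF, h⟩ := t.exists_shortExact X.unop
    exact ⟨.op F, .op T, p.op, i.op, by rw [← op_comp, zero, op_zero], hF, hT, h.op⟩

variable {t}

theorem IsTilting.op (ht : t.IsTilting) : t.op.IsCotilting := fun X =>
  let ⟨T, i, hT, _⟩ := ht X.unop
  ⟨.op T, i.op, hT, inferInstance⟩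

theorem IsCotilting.op (ht : t.IsCotilting) : t.op.IsTilting := fun X =>
  let ⟨F, p, hF, _⟩ := ht X.unop
  ⟨.op F, p.op, hF, inferInstance⟩

variable (t)

/-- The torsion part of `A` includes by the zero morphism, so `A` is isomorphic to its torsion-free
quotient. -/
theorem free_of_hom_eq_zero {A : C} (h : ∀ {T : C}, t.torsion T → ∀ f : T ⟶ A, f = 0) :
    t.free A := by
  have := t.free_isClosedUnderIsomorphisms
  obtain ⟨T, F, i, p, zero, hT, hF, hs⟩ := t.exists_shortExact A
  have hi : i = 0 := h hT i
  have : Mono p := hs.exact.mono_g hi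
  have : Epi p := hs.epi_g
  have : IsIso p := isIso_of_mono_of_epi p
  exact t.free.prop_of_iso (asIso p).symm hF

variable {E : Type u} [Category.{v} E]

/-- Being the right orthogonal of the torsion class gives closure under subobjects and extensions;
the reflection is the torsion-free quotient. -/
theorem isTorsionFreeEmbedding (i : E ⥤ C) (hi : i.essImage = t.free) :
    IsTorsionFreeEmbedding i where
  of_mono {A X} m _ := by
    rw [hi]
    refine t.free_of_hom_eq_zero (fun hT f => ?_)
    rw [← cancel_mono m, zero_comp]
    exact t.hom_eq_zero hT (hi ▸ i.obj_mem_essImage X) _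
  of_shortExact {S} hS h₁ h₃ := by
    rw [hi] at h₁ h₃ ⊢
    refine t.free_of_hom_eq_zero (fun hT f => ?_)
    have := hS.mono_f
    rw [← hS.exact.lift_f f (t.hom_eq_zero hT h₃ _), t.hom_eq_zero hT h₁ (hS.exact.lift f _),
      zero_comp]
  exists_reflection A := by
    obtain ⟨T, F, j, p, zero, hT, hF, hs⟩ := t.exists_shortExact A
    rw [← hi] at hF
    obtain ⟨X, ⟨e⟩⟩ := hF
    have := hs.epi_g
    refine ⟨X, p ≫ e.inv, inferInstance, fun {Z} φ => ?_⟩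
    have h0 : j ≫ φ = 0 := t.hom_eq_zero hT (hi ▸ i.obj_mem_essImage Z) _
    exact ⟨e.hom ≫ hs.exact.desc φ h0, by
      simpa using hs.exact.g_desc φ h0⟩

variable (e : E ≌ t.free.FullSubcategory)

theorem essImage_equivalence : (e.functor ⋙ t.free.ι).essImage = t.free := by
  have := t.free_isClosedUnderIsomorphisms
  ext A
  constructor
  · rintro ⟨X, ⟨i⟩⟩
    exact t.free.prop_of_iso i (e.functor.obj X).property
  · intro hA
    exact ⟨e.inverse.obj ⟨A, hA⟩, ⟨t.free.ι.mapIso (e.counitIso.app ⟨A, hA⟩)⟩⟩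

variable [Preadditive E]

theorem additive_equivalence [HasZeroObject E] [HasBinaryBiproducts E] :
    (e.functor ⋙ t.free.ι).Additive := by
  have := Functor.additive_of_preserves_binary_products e.functor
  infer_instance

include e in
theorem isQuasiAbelian [HasZeroObject E] [HasBinaryBiproducts E] : IsQuasiAbelian E :=
  have := t.additive_equivalence e
  (t.isTorsionFreeEmbedding _ (t.essImage_equivalence e)).isQuasiAbelian

theorem exists_leftHeart_equivalence [HasZeroObject E] [HasBinaryBiproducts E]
    (ht : t.IsCotilting) : ∃ (_ : IsQuasiAbelian E) (Φ : LeftHeart E ≌ C),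
        Nonempty (toLeftHeart E ⋙ Φ.functor ≅ e.functor ⋙ t.free.ι) := by
  have := t.additive_equivalence e
  have := t.isQuasiAbelian e
  refine ⟨this, (t.isTorsionFreeEmbedding _
    (t.essImage_equivalence e)).exists_leftHeart_equivalence (fun A => ?_)⟩
  obtain ⟨F, p, hF, _⟩ := ht A
  rw [← t.essImage_equivalence e] at hF
  obtain ⟨X, ⟨i⟩⟩ := hF
  exact ⟨X, i.hom ≫ p, inferInstance⟩

end

end TorsionPair

/-- The opposite of a full subcategory is a full subcategory of the opposite category. -/
def opFullSubcategory {C : Type w} [Category.{w'} C] (P : ObjectProperty C) :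
    P.FullSubcategoryᵒᵖ ≌ P.op.FullSubcategory where
  functor := P.op.lift P.ι.op (fun X => X.unop.property)
  inverse := (P.lift P.op.ι.leftOp (fun X => X.unop.property)).rightOp
  unitIso := Iso.refl _
  counitIso := Iso.refl _

end QuasiAbelian

end

/-- An additive category is quasi-abelian if and only if it is equivalent to the torsion-free part
of a cotilting torsion pair, if and only if it is equivalent to the torsion part of a tilting
torsion pair. In these situations the ambient abelian category is equivalent to the left,
respectively right, heart, compatibly with the embeddings of the additive category.
(An equivalence between additive categories is automatically an additive functor.) -/
theorem mainTheorem12 (E : Type u) [Category.{v} E] [Preadditive E] [HasZeroObject E]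
    [HasBinaryBiproducts E] :
    List.TFAE
      [IsQuasiAbelian E,
        ∃ (C : Type (max u v)) (_ : Category.{max u v} C) (_ : Abelian C) (t : TorsionPair C),
          t.IsCotilting ∧ Nonempty (E ≌ t.free.FullSubcategory),
        ∃ (C : Type (max u v)) (_ : Category.{max u v} C) (_ : Abelian C) (t : TorsionPair C),
          t.IsTilting ∧ Nonempty (E ≌ t.torsion.FullSubcategory)] ∧
    (∀ (C : Type w) [Category.{w'} C] [Abelian C] (t : TorsionPair C), t.IsCotilting →
      ∀ e : E ≌ t.free.FullSubcategory, ∃ (_ : IsQuasiAbelian E) (Φ : LeftHeart E ≌ C),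
        Nonempty (toLeftHeart E ⋙ Φ.functor ≅ e.functor ⋙ t.free.ι)) ∧
    (∀ (C : Type w) [Category.{w'} C] [Abelian C] (t : TorsionPair C), t.IsTilting →
      ∀ e : E ≌ t.torsion.FullSubcategory, ∃ (_ : IsQuasiAbelian E) (Φ : RightHeart E ≌ C),
        Nonempty (toRightHeart E ⋙ Φ.functor ≅ e.functor ⋙ t.torsion.ι)) := by
  have of_op (h : IsQuasiAbelian Eᵒᵖ) : IsQuasiAbelian E :=
    have := h.op
    IsQuasiAbelian.of_equivalence (opOpEquivalence E)
  refine ⟨?_, fun C _ _ t ht e => t.exists_leftHeart_equivalence e ht, fun C _ _ t ht e => ?_⟩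
  · tfae_have 1 → 2 := fun _ => IsQuasiAbelian.exists_cotilting E
    tfae_have 2 → 1 := fun ⟨C, _, _, t, _, ⟨e⟩⟩ => t.isQuasiAbelian e
    tfae_have 1 → 3 := fun _ => by
      have : IsQuasiAbelian Eᵒᵖ := IsQuasiAbelian.op
      obtain ⟨C, _, _, t, ht, ⟨e⟩⟩ := IsQuasiAbelian.exists_cotilting Eᵒᵖ
      exact ⟨Cᵒᵖ, inferInstance, inferInstance, t.op, ht.op,
        ⟨(opOpEquivalence E).symm.trans (e.op.trans (opFullSubcategory t.free))⟩⟩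
    tfae_have 3 → 1 := fun ⟨C, _, _, t, _, ⟨e⟩⟩ =>
      of_op (t.op.isQuasiAbelian (e.op.trans (opFullSubcategory t.torsion)))
    tfae_finish
  -- The opposite of a tilting pair is cotilting with torsion-free class `Eᵒᵖ`, and the right heart
  -- is the opposite of the left heart of `Eᵒᵖ`.
  · obtain ⟨h, Φ, ⟨i⟩⟩ := t.op.exists_leftHeart_equivalence
      (e.op.trans (opFullSubcategory t.torsion)) ht.op
    refine ⟨of_op h, Φ.op.trans (opOpEquivalence C), ⟨?_⟩⟩
    exact NatIso.ofComponents (fun X => ((i.app (.op X)).unop).symm) (fun {X Y} f =>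
      Quiver.Hom.op_inj (i.inv.naturality f.op).symm)
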